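/- Let $(M^n,g)$ be an $n$-dimensional smooth Riemannian manifold (Hausdorff, second countable, without boundary; neither completeness nor connectedness is required) with Levi-Civita connection $\nabla$ and Riemannian volume $dv_g$. Let $u\in C^\infty(M)$, $V=e^u$, $\lambda,\mu\in\mathbb R$, $\tau=(n+1)\lambda+\mu$, and let $D=D^{\lambda,\mu}$ be the affine connection $$D_XY=\nabla_XY+\lambda\,du(X)\,Y+\lambda\,du(Y)\,X+\mu\,g(X,Y)\nabla u .$$ For a function $f$ write $\nabla^Df=V^{\mu-\lambda}\nabla f$ (the affine gradient), and for a vector field $X$ let $D_iX^i$ be the affine divergence, i.e. the trace of $Y\mapsto D_YX$; in local coordinates $D_iX^i=\partial_iX^i+\Gamma^{D,i}_{\ \ ij}X^j$, where $\Gamma^{D,k}_{\ \ ij}$ are the coefficients of $D$. For a locally integrable field $X$, the Euclidean divergence $\partial_iX^i$ is understood in the sense of distributions in every chart. Let $a\ge 0$ be a locally integrable function and $b\ge 0$ a measurable function on $M$. Let $\omega>0$ be a locally Lipschitz function on $M$ such that the vector field $a\nabla^D\omega$ has an affine divergence $D_i(a\nabla^D_i\omega)$ that is a locally integrable function, and such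 that $$-V^\tau D_i\big(a\nabla^D_i\omega\big)\ \ge\ b\,\omega\,V^{\tau+\mu-\lambda}\qquad\text{almost everywhere in } M .$$ Then for every $\phi\in C_0^\infty(M)$ (smooth with compact support), the functions $a|\nabla^D\phi|^2V^{\tau+\lambda-\mu}$, $b\phi^2V^{\tau+\mu-\lambda}$ and $a\omega^2|\nabla^D(\phi/\omega)|^2V^{\tau+\lambda-\mu}$ are integrable, and $$\int_M\Big(a|\nabla^D\phi|^2V^{\tau+\lambda-\mu}-b\phi^2V^{\tau+\mu-\lambda}\Big)dv_g\ \ge\ \int_M a\,\omega^2\Big|\nabla^D\Big(\frac{\phi}{\omega}\Big)\Big|^2V^{\tau+\lambda-\mu}\,dv_g .$$ -/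

import Mathlib

open MeasureTheory Bundle
open scoped Manifold ContDiff

noncomputable section

namespace AffineHardy

/-- A smooth Riemannian metric on an `n`-dimensional smooth manifold without boundary. -/
abbrev SmoothMetric (n : ℕ) (M : Type*) [TopologicalSpace M]
    [ChartedSpace (EuclideanSpace ℝ (Fin n)) M] [IsManifold (𝓡 n) ∞ M] :=
  ContMDiffRiemannianMetric (𝓡 n) ∞ (EuclideanSpace ℝ (Fin n))
    (fun x : M => TangentSpace (𝓡 n) x)

section Euclidean

variable {n : ℕ}

/-- The partial derivative `∂ᵢ f` of a function on `ℝⁿ`. -/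
def partialDeriv (i : Fin n) (f : EuclideanSpace ℝ (Fin n) → ℝ)
    (y : EuclideanSpace ℝ (Fin n)) : ℝ :=
  fderiv ℝ f y (EuclideanSpace.single i 1)

end Euclidean

section Manifold

variable {n : ℕ} {M : Type*} [TopologicalSpace M] [ChartedSpace (EuclideanSpace ℝ (Fin n)) M]

/-- The coordinate vector field `∂ᵢ` of a chart `e`, at the point with coordinates `y`. -/
def coordVec (e : OpenPartialHomeomorph M (EuclideanSpace ℝ (Fin n)))
    (y : EuclideanSpace ℝ (Fin n)) (i : Fin n) : TangentSpace (𝓡 n) (e.symm y) :=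
  mfderiv (𝓡 n) (𝓡 n) e.symm y (EuclideanSpace.single i (1 : ℝ) : EuclideanSpace ℝ (Fin n))

/-- The `i`-th component `Xⁱ` of a vector field in a chart `e`, as a function of the
coordinates. -/
def coordComp (e : OpenPartialHomeomorph M (EuclideanSpace ℝ (Fin n)))
    (X : (x : M) → TangentSpace (𝓡 n) x) (i : Fin n) (y : EuclideanSpace ℝ (Fin n)) : ℝ :=
  let v : EuclideanSpace ℝ (Fin n) := mfderiv (𝓡 n) (𝓡 n) e (e.symm y) (X (e.symm y))
  v i

/-- A real function on `M` that is locally Lipschitz in every chart of the atlas (equivalently,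
locally Lipschitz for the distance of any Riemannian metric on `M`). -/
def IsLocallyLipschitz (n : ℕ) {M : Type*} [TopologicalSpace M]
    [ChartedSpace (EuclideanSpace ℝ (Fin n)) M] (f : M → ℝ) : Prop :=
  ∀ e ∈ atlas (EuclideanSpace ℝ (Fin n)) M, LocallyLipschitzOn e.target (fun y => f (e.symm y))

variable [IsManifold (𝓡 n) ∞ M] (g : SmoothMetric n M)

/-- The matrix `(g_{ij})` of the metric in a chart. -/
def gram (e : OpenPartialHomeomorph M (EuclideanSpace ℝ (Fin n)))
    (y : EuclideanSpace ℝ (Fin n)) : Matrix (Fin n) (Fin n) ℝ :=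
  Matrix.of fun i j => g.inner (e.symm y) (coordVec e y i) (coordVec e y j)

/-- The measure `√(det g_{ij}) dx¹ ⋯ dxⁿ` of a chart, transported to the source of the chart
and extended by zero to `M`. -/
def chartVolume [MeasurableSpace M] (e : OpenPartialHomeomorph M (EuclideanSpace ℝ (Fin n))) :
    Measure M :=
  Measure.map e.symm
    ((volume.restrict e.target).withDensity fun y => ENNReal.ofReal (√(gram g e y).det))

/-- The Riemannian volume measure `dv_g`. Each chart measure is the restriction of `dv_g` to the
source of the chart, so that `dv_g` is the least measure which dominates all of them. -/
def riemannianVolume [MeasurableSpace M] : Measure M :=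
  ⨆ e ∈ atlas (EuclideanSpace ℝ (Fin n)) M, chartVolume g e

/-- The gradient `∇f` of a real function, i.e. the vector field with `g(∇f, w) = df(w)`. -/
def grad (f : M → ℝ) (x : M) : TangentSpace (𝓡 n) x :=
  (g.inner x).inverse (mfderiv (𝓡 n) 𝓘(ℝ, ℝ) f x)

/-- The defining property of the gradient. -/
theorem inner_grad (f : M → ℝ) (x : M) (w : TangentSpace (𝓡 n) x) :
    g.inner x (grad g f x) w = mfderiv (𝓡 n) 𝓘(ℝ, ℝ) f x w := by
  let E := EuclideanSpace ℝ (Fin n)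
  let B : E →L[ℝ] (E →L[ℝ] ℝ) := g.inner x
  have hinj : Function.Injective (B : E →ₗ[ℝ] (E →L[ℝ] ℝ)) := by
    rw [injective_iff_map_eq_zero]
    intro v hv
    by_contra hne
    have h1 := g.pos x v hne
    have h2 : g.inner x v v = 0 := DFunLike.congr_fun hv v
    exact absurd h2 h1.ne'
  have hdim : Module.finrank ℝ E = Module.finrank ℝ (E →L[ℝ] ℝ) :=
    (InnerProductSpace.toDual ℝ E).toLinearEquiv.finrank_eq
  let L : E ≃L[ℝ] (E →L[ℝ] ℝ) :=
    (LinearEquiv.ofInjectiveOfFinrankEq (B : E →ₗ[ℝ] (E →L[ℝ] ℝ)) hinj hdim).toContinuousLinearEquiv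
  have hL : (L : E →L[ℝ] (E →L[ℝ] ℝ)) = B := by ext v : 1; rfl
  have key : ∀ d : E →L[ℝ] ℝ, B (B.inverse d) = d := by
    intro d
    rw [← hL, ContinuousLinearMap.inverse_equiv]
    exact L.apply_symm_apply d
  exact DFunLike.congr_fun (key (mfderiv (𝓡 n) 𝓘(ℝ, ℝ) f x)) w

/-- `|v|²` with respect to the metric. -/
def normSq {x : M} (v : TangentSpace (𝓡 n) x) : ℝ := g.inner x v v

/-- The Christoffel symbols `Γᵏᵢⱼ` of the Levi-Civita connection in a chart. -/
def christoffel (e : OpenPartialHomeomorph M (EuclideanSpace ℝ (Fin n)))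
    (y : EuclideanSpace ℝ (Fin n)) (k i j : Fin n) : ℝ :=
  (1 / 2) * ∑ l, (gram g e y)⁻¹ k l *
    (partialDeriv i (fun z => gram g e z j l) y + partialDeriv j (fun z => gram g e z i l) y
      - partialDeriv l (fun z => gram g e z i j) y)

/-- The coefficients in a chart of the affine connection
`D_X Y = ∇_X Y + lam du(X) Y + lam du(Y) X + mu g(X, Y) ∇u`, that is,
`D_{∂ᵢ} ∂ⱼ = ∑ₖ (affineCoeff k i j) ∂ₖ`. -/
def affineCoeff (u : M → ℝ) (lam mu : ℝ)
    (e : OpenPartialHomeomorph M (EuclideanSpace ℝ (Fin n)))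
    (y : EuclideanSpace ℝ (Fin n)) (k i j : Fin n) : ℝ :=
  christoffel g e y k i j
    + lam * partialDeriv i (fun z => u (e.symm z)) y * (if k = j then 1 else 0)
    + lam * partialDeriv j (fun z => u (e.symm z)) y * (if k = i then 1 else 0)
    + mu * gram g e y i j * coordComp e (grad g u) k y

/-- The affine gradient `∇ᴰ f = V^(mu - lam) ∇f`, where `V = exp u`. -/
def affineGrad (u : M → ℝ) (lam mu : ℝ) (f : M → ℝ) (x : M) : TangentSpace (𝓡 n) x :=
  (Real.exp (u x) ^ (mu - lam)) • grad g f x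

/-- The locally integrable function `h` is the affine divergence `Dᵢ Xⁱ`, that is, the trace of
`Y ↦ D_Y X`, of the locally integrable vector field `X` in the weak sense: in every chart
`Dᵢ Xⁱ = ∑ᵢ ∂ᵢ Xⁱ + ∑ᵢⱼ (affineCoeff i i j) Xʲ`, where the Euclidean divergence `∑ᵢ ∂ᵢ Xⁱ` is
understood in the sense of distributions on the (open) image of the chart. -/
def HasWeakAffineDiv (u : M → ℝ) (lam mu : ℝ) (X : (x : M) → TangentSpace (𝓡 n) x)
    (h : M → ℝ) : Prop :=
  ∀ e ∈ atlas (EuclideanSpace ℝ (Fin n)) M,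
    (∀ i, LocallyIntegrableOn (coordComp e X i) e.target volume) ∧
    LocallyIntegrableOn (fun y => h (e.symm y)) e.target volume ∧
    ∀ θ : EuclideanSpace ℝ (Fin n) → ℝ, ContDiff ℝ ∞ θ → HasCompactSupport θ →
      tsupport θ ⊆ e.target →
      ∫ y, ∑ i, coordComp e X i y * partialDeriv i θ y =
        - ∫ y, (h (e.symm y) - ∑ i, ∑ j, affineCoeff g u lam mu e y i i j * coordComp e X j y)
            * θ y

end Manifold

end AffineHardy

end

/-! The inequality comes from testing the supersolution `w` against `φ² / w` and completing the
square. With `q = φ / w`, Picone's identity `|∇φ|² - w² |∇q|² = ⟨∇(φ² / w), ∇w⟩` (`picone_identity`)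
holds wherever `w` and `q` are differentiable, hence almost everywhere by Rademacher. Multiplied by
`a V^(τ + mu - lam)` and integrated, its right side becomes `-∫ V^τ h φ² / w` after integration by
parts, `h` being the affine divergence of `a ∇ᴰw`; the differential inequality bounds this below by
`∫ b φ² V^(τ + mu - lam)`.

The integration by parts works because `V^τ dv_g` is adapted to `D`: the traces `∑ᵢ Γᵢᵢⱼ` of the
affine coefficients are the logarithmic derivatives of its density `ρ = √(det g) V^τ`
(`partialDeriv_weight`). So, weakly, `ρ` times the affine divergence of `X` is the Euclidean
divergence of `ρ X`.

The hypothesis on the divergence only speaks of smooth test functions in charts, while `φ² / w` is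
merely Lipschitz. Mollification gives Lipschitz test functions (`weak_div_lipschitz`), and a
partition of unity makes the identity global (`integral_dirDeriv_eq_neg_integral_div`). Integrals
are computed in charts because chart measures agree on overlaps (`chartVolume_eq_of_subset`), so
that their supremum restricts to each of them. -/

namespace AffineHardy

open Set Filter Topology Metric ContinuousLinearMap
open scoped Convolution NNReal

/-! ### Lipschitz functions and their mollifications. -/

section Lipschitz

variable {E : Type*} [NormedAddCommGroup E] [NormedSpace ℝ E] [FiniteDimensional ℝ E]

/-- A function which is locally Lipschitz on an open set and vanishes off a compact subset of it is
globally Lipschitz. -/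
theorem exists_lipschitzWith_of_locallyLipschitzOn {f : E → ℝ} {U K : Set E} (hU : IsOpen U)
    (hf : LocallyLipschitzOn U f) (hK : IsCompact K) (hKU : K ⊆ U) (hfK : ∀ x ∉ K, f x = 0) :
    ∃ C, LipschitzWith C f := by
  have hloc : LocallyLipschitz f := by
    intro x
    by_cases hx : x ∈ K
    · obtain ⟨C, t, ht, hC⟩ := hf (hKU hx)
      rw [hU.nhdsWithin_eq (hKU hx)] at ht
      exact ⟨C, t, ht, hC⟩
    · refine ⟨0, Kᶜ, hK.isClosed.isOpen_compl.mem_nhds hx, ?_⟩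
      intro y hy z hz
      simp [hfK y hy, hfK z hz]
  -- The extra unit of radius puts every point outside the larger ball at distance at least 1 from
  -- `K`; there the sup bound `B` is itself a Lipschitz bound.
  obtain ⟨R, hR⟩ := hK.isBounded.subset_closedBall (0 : E)
  obtain ⟨C, hC⟩ := (hloc.locallyLipschitzOn (s := closedBall (0 : E) (R + 1))
    ).exists_lipschitzOnWith_of_compact (isCompact_closedBall _ _)
  obtain ⟨B, hB⟩ := hK.exists_bound_of_continuousOn hloc.continuous.continuousOn
  have hB' : ∀ x, ‖f x‖ ≤ B.toNNReal := by
    intro x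
    by_cases hx : x ∈ K
    · exact (hB x hx).trans (Real.le_coe_toNNReal B)
    · simp [hfK x hx]
  have key : ∀ x ∈ K, ∀ y, dist (f x) (f y) ≤ ((C + B.toNNReal : ℝ≥0) : ℝ) * dist x y := by
    intro x hx y
    by_cases hy : y ∈ closedBall (0 : E) (R + 1)
    · refine (hC.dist_le_mul x (closedBall_subset_closedBall (by linarith) (hR hx)) y hy).trans ?_
      push_cast
      exact mul_le_mul_of_nonneg_right (by simp) dist_nonneg
    · have hyK : y ∉ K := fun h => hy (closedBall_subset_closedBall (by linarith) (hR h))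
      have h1 : 1 ≤ dist x y := by
        have h2 := hR hx
        simp only [mem_closedBall, not_le] at h2 hy
        have := dist_triangle y x 0
        rw [dist_comm y x] at this
        linarith
      rw [hfK y hyK, dist_zero_right]
      calc ‖f x‖ ≤ B.toNNReal * 1 := by simpa using hB' x
        _ ≤ ((C + B.toNNReal : ℝ≥0) : ℝ) * dist x y := by
          push_cast
          gcongr
          simp
  refine ⟨C + B.toNNReal, LipschitzWith.of_dist_le_mul fun x y => ?_⟩
  by_cases hx : x ∈ K
  · exact key x hx y
  by_cases hy : y ∈ K
  · rw [dist_comm, dist_comm x]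
    exact key y hy x
  · rw [hfK x hx, hfK y hy, dist_self]
    positivity

variable [MeasurableSpace E] [BorelSpace E] {μ : Measure E} [μ.IsAddHaarMeasure]

/-- The derivative of a mollified Lipschitz function is the mollified derivative. -/
theorem hasFDerivAt_normed_convolution [HasContDiffBump E] {f : E → ℝ} {C : ℝ≥0}
    (hf : LipschitzWith C f)
    (ψ : ContDiffBump (0 : E)) (x : E) :
    HasFDerivAt (ψ.normed μ ⋆[lsmul ℝ ℝ, μ] f)
      ((ψ.normed μ ⋆[lsmul ℝ ℝ, μ] (fderiv ℝ f)) x) x := by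
  have hψc : Continuous (ψ.normed μ) := (ψ.contDiff_normed (n := 0)).continuous
  have hψs : HasCompactSupport (ψ.normed μ) := ψ.hasCompactSupport_normed
  have hd : ∀ᵐ t ∂μ, DifferentiableAt ℝ f (x - t) :=
    (quasiMeasurePreserving_sub_left_of_right_invariant μ x).ae hf.ae_differentiableAt
  have hint : Integrable (fun t => C * ψ.normed μ t) μ :=
    (hψc.integrable_of_hasCompactSupport hψs).const_mul _
  have hmeas : ∀ z : E, Continuous fun t => (lsmul ℝ ℝ) (ψ.normed μ t) (f (z - t)) := by
    intro z
    simp only [lsmul_apply, smul_eq_mul]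
    have := hf.continuous
    fun_prop
  -- Differentiation under the integral sign needs the integrand to be differentiable in `z` at `x`
  -- only for almost every `t`, which is Rademacher's theorem; the Lipschitz constant supplies the
  -- domination.
  refine (hasFDerivAt_integral_of_dominated_loc_of_lip (s := univ)
    (bound := fun t => C * ψ.normed μ t) univ_mem
    (Eventually.of_forall fun z => (hmeas z).aestronglyMeasurable) ?_ ?_ ?_ hint ?_).2
  · refine (hmeas x).integrable_of_hasCompactSupport ?_
    simp only [lsmul_apply]
    exact hψs.smul_right
  · simp only [lsmul_apply]
    exact hψc.aestronglyMeasurable.smul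
      ((measurable_fderiv ℝ f).comp (measurable_const.sub measurable_id)).aestronglyMeasurable
  · refine Eventually.of_forall fun t => LipschitzOnWith.of_dist_le_mul fun y _ z _ => ?_
    have h0 : 0 ≤ ψ.normed μ t := ψ.nonneg_normed t
    simp only [lsmul_apply, dist_smul₀, Real.norm_of_nonneg h0, Real.coe_nnabs]
    rw [abs_of_nonneg (by positivity)]
    have := hf.dist_le_mul (y - t) (z - t)
    rw [dist_sub_right] at this
    nlinarith
  · filter_upwards [hd] with t ht
    simp only [lsmul_apply]
    exact HasFDerivAt.const_smul (f := fun z => f (z - t))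
      (ht.hasFDerivAt.comp x ((hasFDerivAt_id x).sub_const t)) (ψ.normed μ t)

theorem norm_normed_convolution_le [HasContDiffBump E] {F : Type*} [NormedAddCommGroup F]
    [NormedSpace ℝ F] {f : E → F} {C : ℝ}
    (hf : ∀ x, ‖f x‖ ≤ C) (ψ : ContDiffBump (0 : E)) (x : E) :
    ‖(ψ.normed μ ⋆[lsmul ℝ ℝ, μ] f) x‖ ≤ C := by
  have hψc : Continuous (ψ.normed μ) := (ψ.contDiff_normed (n := 0)).continuous
  have hψs : HasCompactSupport (ψ.normed μ) := ψ.hasCompactSupport_normed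
  have h : ‖∫ t, (lsmul ℝ ℝ) (ψ.normed μ t) (f (x - t)) ∂μ‖ ≤ ∫ t, ψ.normed μ t * C ∂μ := by
    refine norm_integral_le_of_norm_le
      ((hψc.integrable_of_hasCompactSupport hψs).mul_const C) (Eventually.of_forall fun t => ?_)
    rw [lsmul_apply, norm_smul, Real.norm_of_nonneg (ψ.nonneg_normed t)]
    exact mul_le_mul_of_nonneg_left (hf _) (ψ.nonneg_normed t)
  rwa [integral_mul_const, ψ.integral_normed, one_mul] at h

end Lipschitz

/-! ### Lipschitz test functions for a distributional divergence. -/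

section WeakDivergence

variable {n : ℕ}

local notation "𝔼" => EuclideanSpace ℝ (Fin n)

theorem norm_partialDeriv_le (i : Fin n) (f : 𝔼 → ℝ) (y : 𝔼) :
    ‖partialDeriv i f y‖ ≤ ‖fderiv ℝ f y‖ := by
  simpa [partialDeriv] using (fderiv ℝ f y).le_opNorm (EuclideanSpace.single i 1)

theorem LocallyIntegrableOn.integrable_mul_of_bound {U K : Set 𝔼} {f g : 𝔼 → ℝ} {C : ℝ}
    (hf : LocallyIntegrableOn f U volume) (hK : IsCompact K) (hKU : K ⊆ U)
    (hg : AEStronglyMeasurable g volume) (hgK : ∀ x ∉ K, g x = 0) (hgC : ∀ x, ‖g x‖ ≤ C) :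
    Integrable (fun x => f x * g x) volume := by
  have h1 : IntegrableOn (fun x => f x * g x) K volume :=
    Integrable.mul_bdd (c := C) (hf.integrableOn_compact_subset hKU hK) hg.restrict
      (Eventually.of_forall hgC)
  refine (integrableOn_iff_integrable_of_support_subset ?_).1 h1
  intro x hx
  by_contra h
  exact hx (by simp [hgK x h])

/-- The weak divergence identity extends from smooth to Lipschitz test functions. -/
theorem weak_div_lipschitz {U : Set 𝔼} (hU : IsOpen U) {X : Fin n → 𝔼 → ℝ} {H : 𝔼 → ℝ}
    (hX : ∀ i, LocallyIntegrableOn (X i) U volume) (hH : LocallyIntegrableOn H U volume)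
    (hw : ∀ θ : 𝔼 → ℝ, ContDiff ℝ ∞ θ → HasCompactSupport θ → tsupport θ ⊆ U →
      ∫ y, ∑ i, X i y * partialDeriv i θ y = - ∫ y, H y * θ y)
    {θ : 𝔼 → ℝ} {C : ℝ≥0} (hθ : LipschitzWith C θ) (hθc : HasCompactSupport θ)
    (hθU : tsupport θ ⊆ U) :
    Integrable (fun y => ∑ i, X i y * partialDeriv i θ y) volume ∧
    Integrable (fun y => H y * θ y) volume ∧
    ∫ y, ∑ i, X i y * partialDeriv i θ y = - ∫ y, H y * θ y := by
  obtain ⟨δ, hδ, hδU⟩ := hθc.isCompact.exists_cthickening_subset_open hU hθU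
  set K := cthickening δ (tsupport θ) with hKdef
  have hK : IsCompact K := hθc.isCompact.cthickening
  have hsub : tsupport θ ⊆ K := self_subset_cthickening _
  have hθcont := hθ.continuous
  obtain ⟨B, hB⟩ : ∃ B, ∀ x, ‖θ x‖ ≤ B := hθcont.bounded_above_of_compact_support hθc
  have hfd : ∀ x, ‖fderiv ℝ θ x‖ ≤ C := fun x => norm_fderiv_le_of_lipschitz ℝ hθ
  have hpm : ∀ (f : 𝔼 → ℝ) (i : Fin n), Measurable (partialDeriv i f) := fun f i =>
    measurable_fderiv_apply_const ℝ f _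
  have hzero : ∀ (f : 𝔼 → ℝ), tsupport f ⊆ K → ∀ x ∉ K, f x = 0 ∧ ∀ i, partialDeriv i f x = 0 := by
    intro f hf x hx
    have hx' : x ∉ tsupport f := fun h => hx (hf h)
    refine ⟨image_eq_zero_of_notMem_tsupport hx', fun i => ?_⟩
    have : fderiv ℝ f x = 0 := by
      by_contra hne
      exact hx' (support_fderiv_subset ℝ hne)
    simp [partialDeriv, this]
  -- Outer radii at most `δ` keep the supports of the mollified functions in `K`. The fixed ratio 2
  -- of outer to inner radius is what the almost everywhere convergence of the gradients requires.
  let ψ : ℕ → ContDiffBump (0 : 𝔼) := fun m =>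
    ⟨δ / (m + 1) / 2, δ / (m + 1), by positivity, half_lt_self (by positivity)⟩
  have hr : Tendsto (fun m => (ψ m).rOut) atTop (𝓝 0) := by
    have := tendsto_one_div_add_atTop_nhds_zero_nat (𝕜 := ℝ)
    simpa [ψ, div_eq_mul_inv] using this.const_mul δ
  let T : ℕ → 𝔼 → ℝ := fun m => (ψ m).normed volume ⋆[lsmul ℝ ℝ, volume] θ
  have hTs : ∀ m, ContDiff ℝ ∞ (T m) := fun m =>
    HasCompactSupport.contDiff_convolution_left _ (ψ m).hasCompactSupport_normed
      (ψ m).contDiff_normed hθcont.locallyIntegrable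
  have hTsupp : ∀ m, tsupport (T m) ⊆ K := by
    intro m
    refine closure_minimal ?_ isClosed_cthickening
    refine (support_convolution_subset _).trans ?_
    rw [(ψ m).support_normed_eq]
    rintro _ ⟨a, ha, b, hb, rfl⟩
    refine mem_cthickening_of_dist_le _ b _ _ (subset_closure hb) ?_
    simp only [mem_ball, dist_zero_right, ψ] at ha
    simp only [dist_eq_norm, add_sub_cancel_right]
    exact ha.le.trans (div_le_self hδ.le (by simp))
  have hTc : ∀ m, HasCompactSupport (T m) := fun m =>
    hK.of_isClosed_subset (isClosed_tsupport _) (hTsupp m)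
  have hTB : ∀ m x, ‖T m x‖ ≤ B := fun m x => norm_normed_convolution_le hB _ _
  have hTd : ∀ m x, fderiv ℝ (T m) x =
      ((ψ m).normed volume ⋆[lsmul ℝ ℝ, volume] (fderiv ℝ θ)) x := fun m x =>
    (hasFDerivAt_normed_convolution hθ (ψ m) x).fderiv
  have hTdC : ∀ m x, ‖fderiv ℝ (T m) x‖ ≤ C := fun m x => by
    rw [hTd]
    exact norm_normed_convolution_le hfd _ _
  have hlim : ∀ x, Tendsto (fun m => T m x) atTop (𝓝 (θ x)) := fun x =>
    ContDiffBump.convolution_tendsto_right_of_continuous hr hθcont x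
  -- The gradient of `θ` is only bounded and measurable, so its mollifications converge at Lebesgue
  -- points. This suffices for dominated convergence, with the uniform bound `C` on the gradients.
  have hlimd : ∀ᵐ x, Tendsto (fun m => fderiv ℝ (T m) x) atTop (𝓝 (fderiv ℝ θ x)) := by
    have hloc : LocallyIntegrable (fderiv ℝ θ) volume :=
      (memLp_top_of_bound (measurable_fderiv ℝ θ).aestronglyMeasurable (C : ℝ)
        (Eventually.of_forall hfd)).locallyIntegrable le_top
    have := ContDiffBump.ae_convolution_tendsto_right_of_locallyIntegrable (μ := volume) (K := 2) hr
      (Eventually.of_forall fun m => by simp [ψ]; linarith) hloc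
    simpa only [hTd] using this
  have hbd1 : Integrable (fun y => |H y| * K.indicator (fun _ => B) y) volume := by
    have : LocallyIntegrableOn (fun y => |H y|) U volume := hH.norm
    refine LocallyIntegrableOn.integrable_mul_of_bound (C := |B|) this hK hδU
      (aestronglyMeasurable_const.indicator hK.measurableSet)
      (fun x hx => by simp [hx]) (fun x => ?_)
    by_cases hx : x ∈ K <;> simp [hx]
  have hbd2 : ∀ i, Integrable (fun y => |X i y| * K.indicator (fun _ => (C : ℝ)) y) volume := by
    intro i
    have : LocallyIntegrableOn (fun y => |X i y|) U volume := (hX i).norm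
    refine LocallyIntegrableOn.integrable_mul_of_bound (C := C) this hK hδU
      (aestronglyMeasurable_const.indicator hK.measurableSet)
      (fun x hx => by simp [hx]) (fun x => ?_)
    by_cases hx : x ∈ K <;> simp [hx]
  have hI1 : ∀ (f : 𝔼 → ℝ), tsupport f ⊆ K → (∀ x, ‖fderiv ℝ f x‖ ≤ C) → ∀ i,
      Integrable (fun y => X i y * partialDeriv i f y) volume := fun f hf hfC i =>
    LocallyIntegrableOn.integrable_mul_of_bound (hX i) hK hδU (hpm f i).aestronglyMeasurable
      (fun x hx => (hzero f hf x hx).2 i) (fun x => (norm_partialDeriv_le i f x).trans (hfC x))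
  have hI2 : ∀ (f : 𝔼 → ℝ), Continuous f → tsupport f ⊆ K → (∀ x, ‖f x‖ ≤ B) →
      Integrable (fun y => H y * f y) volume := fun f hfc hf hfB =>
    LocallyIntegrableOn.integrable_mul_of_bound hH hK hδU hfc.aestronglyMeasurable
      (fun x hx => (hzero f hf x hx).1) hfB
  have hIθ := hI2 θ hθcont hsub hB
  refine ⟨integrable_finsetSum _ fun i _ => hI1 θ hsub hfd i, hIθ, ?_⟩
  have hL2 : Tendsto (fun m => ∫ y, H y * T m y) atTop (𝓝 (∫ y, H y * θ y)) := by
    refine tendsto_integral_of_dominated_convergence _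
      (fun m => (hI2 _ (hTs m).continuous (hTsupp m) (hTB m)).aestronglyMeasurable) hbd1
      (fun m => Eventually.of_forall fun y => ?_)
      (Eventually.of_forall fun y => (hlim y).const_mul _)
    by_cases hy : y ∈ K
    · rw [norm_mul, indicator_of_mem hy]
      exact mul_le_mul_of_nonneg_left (hTB m y) (abs_nonneg _)
    · simp [hy, (hzero _ (hTsupp m) y hy).1]
  have hL1 : ∀ i, Tendsto (fun m => ∫ y, X i y * partialDeriv i (T m) y) atTop
      (𝓝 (∫ y, X i y * partialDeriv i θ y)) := by
    intro i
    refine tendsto_integral_of_dominated_convergence _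
      (fun m => (hI1 _ (hTsupp m) (hTdC m) i).aestronglyMeasurable) (hbd2 i)
      (fun m => Eventually.of_forall fun y => ?_) ?_
    · by_cases hy : y ∈ K
      · rw [norm_mul, indicator_of_mem hy]
        exact mul_le_mul_of_nonneg_left ((norm_partialDeriv_le i _ y).trans (hTdC m y))
          (abs_nonneg _)
      · simp [hy, (hzero _ (hTsupp m) y hy).2 i]
    · filter_upwards [hlimd] with y hy
      exact ((ContinuousLinearMap.apply ℝ ℝ
        (EuclideanSpace.single i (1 : ℝ))).continuous.continuousAt.tendsto.comp hy).const_mul _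
  have hL1' := tendsto_finsetSum Finset.univ fun i _ => hL1 i
  rw [integral_finsetSum _ fun i _ => hI1 θ hsub hfd i]
  refine tendsto_nhds_unique (hL1'.congr fun m => ?_) hL2.neg
  rw [← integral_finsetSum _ fun i _ => hI1 _ (hTsupp m) (hTdC m) i]
  exact hw (T m) (hTs m) (hTc m) ((hTsupp m).trans hδU)

end WeakDivergence

/-! ### Derivative of the determinant. -/

section Determinant

variable {ι E : Type*} [Fintype ι] [DecidableEq ι] [NormedAddCommGroup E] [NormedSpace ℝ E]

/-- Jacobi's formula for the derivative of a determinant. -/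
theorem hasFDerivAt_det {G : E → Matrix ι ι ℝ} {G' : ι → ι → E →L[ℝ] ℝ} {y : E}
    (hG : ∀ i j, HasFDerivAt (fun z => G z i j) (G' i j) y) (h0 : (G y).det ≠ 0) :
    HasFDerivAt (fun z => (G z).det) ((G y).det • ∑ i, ∑ j, (G y)⁻¹ j i • G' i j) y := by
  let D : ContinuousMultilinearMap ℝ (fun _ : ι => ι → ℝ) ℝ :=
    { (Matrix.detRowAlternating (n := ι) (R := ℝ)).toMultilinearMap with
      cont := Continuous.matrix_det continuous_id }
  have hG' : HasFDerivAt (fun z => (fun i j => G z i j : ι → ι → ℝ))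
      (ContinuousLinearMap.pi fun i => ContinuousLinearMap.pi fun j => G' i j) y :=
    hasFDerivAt_pi.2 fun i => hasFDerivAt_pi.2 fun j => hG i j
  have h := (D.hasFDerivAt (fun i j => G y i j)).comp y hG'
  refine h.congr_fderiv ?_
  ext v
  -- The determinant is multilinear in the rows, so its derivative replaces one row at a time;
  -- Cramer's rule evaluates each term through the adjugate.
  have key : ∀ i, (D.toMultilinearMap (Function.update (fun i j => G y i j) i (fun j => G' i j v))) =
      (G y).det * ∑ j, (G y)⁻¹ j i * G' i j v := by
    intro i
    change ((G y).updateRow i (fun j => G' i j v)).det = _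
    rw [← Matrix.cramer_transpose_apply, Matrix.cramer_eq_adjugate_mulVec, ← Matrix.adjugate_transpose,
      Matrix.inv_def, Matrix.mulVec, dotProduct, Finset.mul_sum]
    refine Finset.sum_congr rfl fun j _ => ?_
    simp only [Matrix.transpose_apply, Matrix.smul_apply, smul_eq_mul]
    rw [Ring.inverse_eq_inv', ← mul_assoc, mul_inv_cancel_left₀ h0]
  simp only [ContinuousLinearMap.comp_apply, ContinuousMultilinearMap.linearDeriv_apply,
    _root_.smul_apply, _root_.sum_apply, smul_eq_mul, Finset.mul_sum]
  refine Finset.sum_congr rfl fun i _ => ?_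
  rw [← Finset.mul_sum]
  exact key i

end Determinant

/-! ### The metric, gradients and the trace of the affine connection in a chart. -/

section ChartGeometry

variable {n : ℕ} {M : Type*} [TopologicalSpace M] [ChartedSpace (EuclideanSpace ℝ (Fin n)) M]
  [IsManifold (𝓡 n) ∞ M] (g : SmoothMetric n M)
  {e : OpenPartialHomeomorph M (EuclideanSpace ℝ (Fin n))}

local notation "𝔼" => EuclideanSpace ℝ (Fin n)

theorem chart_mdifferentiable (he : e ∈ atlas 𝔼 M) :
    e.MDifferentiable (𝓡 n) (𝓡 n) :=
  have : IsManifold (𝓡 n) 1 M := .of_le (n := ∞) (by simp)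
  mdifferentiable_of_mem_atlas he

theorem chart_symm_contMDiffOn (he : e ∈ atlas 𝔼 M) :
    ContMDiffOn (𝓡 n) (𝓡 n) ∞ e.symm e.target :=
  contMDiffOn_symm_of_mem_maximalAtlas (IsManifold.subset_maximalAtlas he)

theorem comp_chart_symm_contDiffOn (he : e ∈ atlas 𝔼 M) {f : M → ℝ}
    (hf : ContMDiff (𝓡 n) 𝓘(ℝ, ℝ) ∞ f) : ContDiffOn ℝ ∞ (fun y => f (e.symm y)) e.target :=
  contMDiffOn_iff_contDiffOn.1 (hf.comp_contMDiffOn (chart_symm_contMDiffOn he))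

omit [IsManifold (𝓡 n) ∞ M] in
theorem mfderiv_chart_symm_eq_sum (y v : 𝔼) :
    mfderiv (𝓡 n) (𝓡 n) e.symm y v = ∑ i, v i • coordVec e y i := by
  have hv : v = ∑ i, v i • (EuclideanSpace.single i (1 : ℝ) : 𝔼) := by
    ext j
    simp [Pi.single_apply]
  conv_lhs => rw [hv]
  let L : 𝔼 →L[ℝ] 𝔼 := mfderiv (𝓡 n) (𝓡 n) e.symm y
  change L _ = _
  rw [map_sum]
  exact Finset.sum_congr rfl fun i _ => map_smul L _ _

/-- A vector field is the combination of coordinate vector fields given by its components. -/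
theorem eq_sum_coordComp (he : e ∈ atlas 𝔼 M) (X : (x : M) → TangentSpace (𝓡 n) x) {y : 𝔼}
    (hy : y ∈ e.target) :
    X (e.symm y) = ∑ i, coordComp e X i y • coordVec e y i := by
  have h := (chart_mdifferentiable he).symm_comp_deriv (e.map_target hy)
  have h2 := DFunLike.congr_fun h (X (e.symm y))
  rw [e.right_inv hy] at h2
  exact h2.symm.trans (mfderiv_chart_symm_eq_sum y _)

/-- The coordinate field is the tangent map of `e.symm` applied to a constant section. Order 1 is
enough, since only first derivatives of the metric enter. -/
theorem coordVec_section_contMDiffOn (he : e ∈ atlas 𝔼 M) (i : Fin n) :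
    ContMDiffOn (𝓡 n) (𝓡 n).tangent 1
      (fun y => (⟨e.symm y, coordVec e y i⟩ : TangentBundle (𝓡 n) M)) e.target := by
  have : IsManifold (𝓡 n) 1 M := .of_le (n := ∞) (by simp)
  have h := (chart_symm_contMDiffOn he).contMDiffOn_tangentMapWithin (m := 1)
    (by norm_cast) e.open_target.uniqueMDiffOn
  have hs : ContMDiff (𝓡 n) (𝓡 n).tangent 1
      (fun y => (⟨y, (EuclideanSpace.single i (1 : ℝ) : 𝔼)⟩ : TangentBundle (𝓡 n) 𝔼)) := by
    intro y
    exact contMDiffAt_vectorSpace_iff_contDiffAt.2 contDiffAt_const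
  refine (h.comp hs.contMDiffOn (s := e.target) fun y hy => hy).congr fun y hy => ?_
  simp only [Function.comp, tangentMapWithin, coordVec]
  rw [mfderivWithin_of_mem_nhds (e.open_target.mem_nhds hy)]

theorem gram_contDiffOn (he : e ∈ atlas 𝔼 M) (i j : Fin n) :
    ContDiffOn ℝ 1 (fun y => gram g e y i j) e.target := by
  have : IsManifold (𝓡 n) 1 M := .of_le (n := ∞) (by simp)
  rw [← contMDiffOn_iff_contDiffOn]
  intro y hy
  have h1 : ContMDiffWithinAt (𝓡 n) ((𝓡 n).prod 𝓘(ℝ)) 1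
      (fun m ↦ TotalSpace.mk' ℝ (E := Bundle.Trivial M ℝ) (e.symm m)
        (g.inner (e.symm m) (coordVec e m i) (coordVec e m j))) e.target y := by
    apply ContMDiffWithinAt.clm_bundle_apply₂ (F₁ := 𝔼) (F₂ := 𝔼)
    · exact ContMDiffAt.comp_contMDiffWithinAt y (g.contMDiff.of_le (by simp)).contMDiffAt
        ((chart_symm_contMDiffOn he y hy).of_le (by simp))
    · exact coordVec_section_contMDiffOn he i y hy
    · exact coordVec_section_contMDiffOn he j y hy
  simp only [contMDiffWithinAt_totalSpace] at h1
  exact h1.2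

theorem gram_symm (y : 𝔼) (i j : Fin n) : gram g e y i j = gram g e y j i :=
  g.symm _ _ _

/-- The metric in coordinates. -/
theorem inner_sum_coordVec (y : 𝔼) (a b : Fin n → ℝ) :
    g.inner (e.symm y) (∑ i, a i • coordVec e y i) (∑ j, b j • coordVec e y j) =
      ∑ i, ∑ j, a i * b j * gram g e y i j := by
  simp only [map_sum, map_smul, _root_.sum_apply, _root_.smul_apply, smul_eq_mul, gram,
    Matrix.of_apply]
  rw [Finset.sum_comm]
  refine Finset.sum_congr rfl fun i _ => ?_
  rw [Finset.mul_sum]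
  exact Finset.sum_congr rfl fun j _ => by ring

theorem gram_posDef (he : e ∈ atlas 𝔼 M) {y : 𝔼} (hy : y ∈ e.target) : (gram g e y).PosDef := by
  refine Matrix.PosDef.of_dotProduct_mulVec_pos ?_ fun x hx => ?_
  · ext i j
    simp [gram_symm g y i j]
  · have h : star x ⬝ᵥ (gram g e y).mulVec x =
        g.inner (e.symm y) (∑ i, x i • coordVec e y i) (∑ j, x j • coordVec e y j) := by
      rw [inner_sum_coordVec]
      simp only [dotProduct, Matrix.mulVec, Finset.mul_sum, star_trivial]
      exact Finset.sum_congr rfl fun i _ => Finset.sum_congr rfl fun j _ => by ring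
    rw [h]
    -- The combination of coordinate vectors is the image of `x` under the differential of `e.symm`,
    -- which is injective on the target.
    refine g.pos _ _ fun h0 => hx ?_
    have h1 := mfderiv_chart_symm_eq_sum (e := e) y (WithLp.toLp 2 x)
    have h2 := (h1.trans h0)
    have h3 := (chart_mdifferentiable he).symm.mfderiv_injective hy
    have h4 := h3 (h2.trans (map_zero _).symm)
    ext i
    exact congrArg (fun v : 𝔼 => v i) h4

theorem mdifferentiableAt_iff_chart (he : e ∈ atlas 𝔼 M) {f : M → ℝ} {y : 𝔼} (hy : y ∈ e.target) :
    MDifferentiableAt (𝓡 n) 𝓘(ℝ, ℝ) f (e.symm y) ↔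
      DifferentiableAt ℝ (fun z => f (e.symm z)) y := by
  rw [← mdifferentiableAt_iff_differentiableAt]
  refine ⟨fun h => h.comp y ((chart_mdifferentiable he).mdifferentiableAt_symm hy), fun h => ?_⟩
  rw [← e.right_inv hy] at h
  have h1 := h.comp (e.symm y) ((chart_mdifferentiable he).mdifferentiableAt (e.map_target hy))
  refine h1.congr_of_eventuallyEq ?_
  filter_upwards [e.open_source.mem_nhds (e.map_target hy)] with x hx
  simp [e.left_inv hx]

theorem mfderiv_coordVec (he : e ∈ atlas 𝔼 M) (f : M → ℝ) {y : 𝔼} (hy : y ∈ e.target)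
    (i : Fin n) : mfderiv (𝓡 n) 𝓘(ℝ, ℝ) f (e.symm y) (coordVec e y i) =
      partialDeriv i (fun z => f (e.symm z)) y := by
  by_cases hf : MDifferentiableAt (𝓡 n) 𝓘(ℝ, ℝ) f (e.symm y)
  · have h := mfderiv_comp y hf ((chart_mdifferentiable he).mdifferentiableAt_symm hy)
    rw [mfderiv_eq_fderiv] at h
    exact (DFunLike.congr_fun h (EuclideanSpace.single i (1 : ℝ) : 𝔼)).symm
  -- Without differentiability both derivatives take their default value 0, so the formula holds for
  -- every `f`.
  · rw [mfderiv_zero_of_not_mdifferentiableAt hf, partialDeriv, fderiv_zero_of_not_differentiableAt]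
    · rfl
    · rwa [← mdifferentiableAt_iff_chart he hy]

/-- The differential of a function along a vector field in coordinates. -/
theorem mfderiv_eq_sum_coordComp (he : e ∈ atlas 𝔼 M) (f : M → ℝ)
    (X : (x : M) → TangentSpace (𝓡 n) x) {y : 𝔼} (hy : y ∈ e.target) :
    mfderiv (𝓡 n) 𝓘(ℝ, ℝ) f (e.symm y) (X (e.symm y)) =
      ∑ i, coordComp e X i y * partialDeriv i (fun z => f (e.symm z)) y := by
  rw [eq_sum_coordComp he X hy, map_sum]
  refine Finset.sum_congr rfl fun i _ => ?_
  rw [map_smul, mfderiv_coordVec he f hy]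
  rfl

theorem sum_gram_mul_coordComp_grad (he : e ∈ atlas 𝔼 M) (f : M → ℝ) {y : 𝔼} (hy : y ∈ e.target)
    (j : Fin n) : ∑ i, gram g e y i j * coordComp e (grad g f) i y =
      partialDeriv j (fun z => f (e.symm z)) y := by
  rw [← mfderiv_coordVec he f hy, ← inner_grad g, eq_sum_coordComp he (grad g f) hy]
  simp only [map_sum, map_smul, _root_.sum_apply, _root_.smul_apply, smul_eq_mul, gram,
    Matrix.of_apply]
  exact Finset.sum_congr rfl fun i _ => mul_comm _ _

/-- In the trace, the first and third derivative terms of the Christoffel symbol cancel by the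
symmetry of the metric and its inverse. -/
theorem sum_christoffel (y : 𝔼) (j : Fin n) :
    ∑ i, christoffel g e y i i j =
      (1 / 2) * ∑ i, ∑ l, (gram g e y)⁻¹ i l * partialDeriv j (fun z => gram g e z i l) y := by
  have hG : (gram g e y).transpose = gram g e y := by
    ext a b
    exact gram_symm g y b a
  have hinv : ∀ a b, (gram g e y)⁻¹ a b = (gram g e y)⁻¹ b a := fun a b => by
    conv_lhs => rw [← hG, ← Matrix.transpose_nonsing_inv, Matrix.transpose_apply]
  have hsym : ∀ a b, (fun z => gram g e z a b) = fun z => gram g e z b a := fun a b =>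
    funext fun z => gram_symm g z a b
  have h0 : ∑ i, ∑ l, (gram g e y)⁻¹ i l * partialDeriv i (fun z => gram g e z j l) y =
      ∑ i, ∑ l, (gram g e y)⁻¹ i l * partialDeriv l (fun z => gram g e z i j) y := by
    rw [Finset.sum_comm]
    refine Finset.sum_congr rfl fun l _ => Finset.sum_congr rfl fun i _ => ?_
    rw [hinv, hsym j l]
  simp only [christoffel]
  rw [← Finset.mul_sum]
  simp only [mul_sub, mul_add, Finset.sum_sub_distrib, Finset.sum_add_distrib]
  rw [h0]
  ring

/-- The two `lam` terms contribute `lam` and `n * lam`, since the traced deltas are 1 and `n`;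
lowering the index of `∇u` turns the last term into `mu ∂ⱼu`. This is the origin of `τ`. -/
theorem sum_affineCoeff (he : e ∈ atlas 𝔼 M) (u : M → ℝ) (lam mu : ℝ) {y : 𝔼} (hy : y ∈ e.target)
    (j : Fin n) : ∑ i, affineCoeff g u lam mu e y i i j = ∑ i, christoffel g e y i i j +
      ((n + 1) * lam + mu) * partialDeriv j (fun z => u (e.symm z)) y := by
  rw [← sum_gram_mul_coordComp_grad g he u hy j]
  simp only [affineCoeff, Finset.sum_add_distrib]
  rw [sum_gram_mul_coordComp_grad g he u hy j]
  have h1 : ∑ i, mu * gram g e y i j * coordComp e (grad g u) i y =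
      mu * partialDeriv j (fun z => u (e.symm z)) y := by
    rw [← sum_gram_mul_coordComp_grad g he u hy j, Finset.mul_sum]
    exact Finset.sum_congr rfl fun i _ => by ring
  rw [h1]
  simp
  ring

/-- The density of the weighted volume `V^τ dv_g` in a chart, where `V = exp u`. -/
noncomputable def weight (u : M → ℝ) (τ : ℝ) (e : OpenPartialHomeomorph M 𝔼) (y : 𝔼) : ℝ :=
  √(gram g e y).det * Real.exp (u (e.symm y)) ^ τ

theorem sqrt_det_gram_contDiffOn (he : e ∈ atlas 𝔼 M) :
    ContDiffOn ℝ 1 (fun y => √(gram g e y).det) e.target := by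
  refine ContDiffOn.sqrt ?_ fun y hy => (gram_posDef g he hy).det_pos.ne'
  simp only [Matrix.det_apply]
  refine ContDiffOn.sum fun σ _ => ContDiffOn.const_smul _ ?_
  exact contDiffOn_prod fun i _ => gram_contDiffOn g he _ _

theorem weight_contDiffOn (he : e ∈ atlas 𝔼 M) {u : M → ℝ} (hu : ContMDiff (𝓡 n) 𝓘(ℝ, ℝ) ∞ u)
    (τ : ℝ) : ContDiffOn ℝ 1 (weight g u τ e) e.target := by
  refine (sqrt_det_gram_contDiffOn g he).mul ?_
  refine ContDiffOn.rpow_const_of_ne ?_ fun y _ => (Real.exp_pos _).ne'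
  exact ((comp_chart_symm_contDiffOn he hu).of_le (by simp)).exp

theorem weight_pos (he : e ∈ atlas 𝔼 M) (u : M → ℝ) (τ : ℝ) {y : 𝔼} (hy : y ∈ e.target) :
    0 < weight g u τ e y :=
  mul_pos (Real.sqrt_pos.2 (gram_posDef g he hy).det_pos) (Real.rpow_pos_of_pos (Real.exp_pos _) _)

/-- The trace of the coefficients of the affine connection is the logarithmic derivative of the
weighted volume density. -/
theorem partialDeriv_weight (he : e ∈ atlas 𝔼 M) {u : M → ℝ} (hu : ContMDiff (𝓡 n) 𝓘(ℝ, ℝ) ∞ u)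
    (lam mu : ℝ) {y : 𝔼} (hy : y ∈ e.target) (j : Fin n) :
    partialDeriv j (weight g u ((n + 1) * lam + mu) e) y =
      weight g u ((n + 1) * lam + mu) e y * ∑ i, affineCoeff g u lam mu e y i i j := by
  rw [sum_affineCoeff g he u lam mu hy, sum_christoffel]
  set τ := (n + 1) * lam + mu
  have hnhds := e.open_target.mem_nhds hy
  have hdet := (gram_posDef g he hy).det_pos
  have hgram : ∀ i l, HasFDerivAt (fun z => gram g e z i l) (fderiv ℝ (fun z => gram g e z i l) y) y :=
    fun i l => (((gram_contDiffOn g he i l).differentiableOn (by simp)).differentiableAt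
      hnhds).hasFDerivAt
  have hu' : HasFDerivAt (fun z => u (e.symm z)) (fderiv ℝ (fun z => u (e.symm z)) y) y :=
    (((comp_chart_symm_contDiffOn he hu).differentiableOn (by simp)).differentiableAt
      hnhds).hasFDerivAt
  -- Jacobi's formula under the square root yields half the trace of `g⁻¹ ∂ⱼg`, which is the traced
  -- Christoffel symbol; the exponential factor yields `τ ∂ⱼu`.
  have h1 := (hasFDerivAt_det hgram hdet.ne').sqrt hdet.ne'
  have h2 := (hu'.mul_const τ).exp
  have hw : weight g u τ e = fun z => √(gram g e z).det * Real.exp (u (e.symm z) * τ) := by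
    funext z
    rw [weight, Real.exp_mul]
  have h3 := h1.fun_mul h2
  rw [hw]
  unfold partialDeriv
  rw [h3.fderiv]
  have hsq : √(gram g e y).det ^ 2 = (gram g e y).det := Real.sq_sqrt hdet.le
  have hsum : ∑ i, ∑ l, (gram g e y)⁻¹ l i *
        (fderiv ℝ (fun z => gram g e z i l) y) (EuclideanSpace.single j 1) =
      ∑ i, ∑ l, (gram g e y)⁻¹ i l *
        (fderiv ℝ (fun z => gram g e z i l) y) (EuclideanSpace.single j 1) := by
    rw [Finset.sum_comm]
    refine Finset.sum_congr rfl fun l _ => Finset.sum_congr rfl fun i _ => ?_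
    have : (fun z => gram g e z i l) = fun z => gram g e z l i := funext fun z => gram_symm g z i l
    rw [this]
  simp only [_root_.add_apply, _root_.smul_apply, _root_.sum_apply, smul_eq_mul]
  rw [hsum]
  have hs0 : √(gram g e y).det ≠ 0 := (Real.sqrt_pos.2 hdet).ne'
  generalize √(gram g e y).det = s at *
  rw [← hsq]
  field_simp
  ring

end ChartGeometry

/-! ### Riemannian volume and integration in charts. -/

section Volume

variable {n : ℕ} {M : Type*} [TopologicalSpace M] [ChartedSpace (EuclideanSpace ℝ (Fin n)) M]
  [IsManifold (𝓡 n) ∞ M] (g : SmoothMetric n M)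
  {e e' : OpenPartialHomeomorph M (EuclideanSpace ℝ (Fin n))}

local notation "𝔼" => EuclideanSpace ℝ (Fin n)

/-- The Gram determinants in two charts differ by the squared Jacobian of the transition map. -/
theorem det_gram_change (he : e ∈ atlas 𝔼 M) (he' : e' ∈ atlas 𝔼 M) {y : 𝔼} (hy : y ∈ e.target)
    (hy' : e.symm y ∈ e'.source) :
    (gram g e y).det =
      (fderiv ℝ (fun z => e' (e.symm z)) y).det ^ 2 * (gram g e' (e' (e.symm y))).det := by
  set T : 𝔼 → 𝔼 := fun z => e' (e.symm z) with hT
  set L := fderiv ℝ T y with hL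
  let b := (EuclideanSpace.basisFun (Fin n) ℝ).toBasis
  let J : Matrix (Fin n) (Fin n) ℝ := LinearMap.toMatrix b b (L : 𝔼 →ₗ[ℝ] 𝔼)
  have hJ : J.det = L.det := LinearMap.det_toMatrix b _
  have hJap : ∀ k i, J k i = L (EuclideanSpace.single i 1) k := by
    intro k i
    simp [J, b, LinearMap.toMatrix_apply]
  have hTx : e'.symm (T y) = e.symm y := e'.left_inv hy'
  have hTt : T y ∈ e'.target := e'.map_source hy'
  -- The base points in the two charts are only propositionally equal. Viewing all tangent spaces as
  -- the one space `𝔼` allows rewriting along this equality.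
  let c : OpenPartialHomeomorph M 𝔼 → 𝔼 → Fin n → 𝔼 := fun e y i => coordVec e y i
  let G : M → 𝔼 →L[ℝ] 𝔼 →L[ℝ] ℝ := fun x => g.inner x
  have hTd : MDifferentiableAt (𝓡 n) (𝓡 n) T y :=
    ((chart_mdifferentiable he').mdifferentiableAt hy').comp y
      ((chart_mdifferentiable he).mdifferentiableAt_symm hy)
  have hcomp : ∀ i, c e y i = ∑ k, J k i • c e' (T y) k := by
    intro i
    have h1 : e'.symm ∘ T =ᶠ[𝓝 y] e.symm := by
      have : e.symm ⁻¹' e'.source ∈ 𝓝 y :=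
        (e.continuousAt_symm hy).preimage_mem_nhds (e'.open_source.mem_nhds hy')
      filter_upwards [this] with z hz
      exact e'.left_inv hz
    have h2 := mfderiv_comp y ((chart_mdifferentiable he').mdifferentiableAt_symm hTt) hTd
    rw [h1.mfderiv_eq, mfderiv_eq_fderiv] at h2
    have h3 := DFunLike.congr_fun h2 (EuclideanSpace.single i (1 : ℝ) : 𝔼)
    refine h3.trans ((mfderiv_chart_symm_eq_sum (e := e') (T y) (L (EuclideanSpace.single i 1))).trans
      (Finset.sum_congr rfl fun k _ => ?_))
    rw [hJap]
    rfl
  have hgram : gram g e y = J.transpose * gram g e' (T y) * J := by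
    ext i j
    have h1 : gram g e y i j = G (e.symm y) (c e y i) (c e y j) := rfl
    have h2 : ∀ k l, gram g e' (T y) k l = G (e.symm y) (c e' (T y) k) (c e' (T y) l) := by
      intro k l
      rw [← hTx]
      rfl
    rw [h1, hcomp, hcomp]
    simp only [map_sum, map_smul, _root_.sum_apply, _root_.smul_apply, smul_eq_mul, Matrix.mul_apply,
      Matrix.transpose_apply, h2]
    refine Finset.sum_congr rfl fun l _ => ?_
    rw [Finset.sum_mul, Finset.mul_sum]
    exact Finset.sum_congr rfl fun k _ => by ring
  rw [hgram, Matrix.det_mul, Matrix.det_mul, Matrix.det_transpose, hJ]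
  ring

variable [MeasurableSpace M] [BorelSpace M]

omit [ChartedSpace (EuclideanSpace ℝ (Fin n)) M] [IsManifold (𝓡 n) ∞ M] in
theorem measurableSet_target_inter_preimage {A : Set M} (hA : MeasurableSet A) :
    MeasurableSet (e.target ∩ e.symm ⁻¹' A) := by
  have h : Measurable fun y : e.target => e.symm y :=
    (continuousOn_iff_continuous_domRestrict.1 e.continuousOn_symm).measurable
  have := e.open_target.measurableSet.subtype_image (h hA)
  convert this using 1
  ext y
  simp [and_comm]

-- Off `e.target` the values of `e.symm` are unconstrained, so measurability is claimed only almost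
-- everywhere, for measures that do not see the complement.
omit [ChartedSpace (EuclideanSpace ℝ (Fin n)) M] [IsManifold (𝓡 n) ∞ M] in
theorem aemeasurable_chart_symm {ν : Measure 𝔼} (hν : ν ≪ volume.restrict e.target) :
    AEMeasurable e.symm ν :=
  (e.continuousOn_symm.aemeasurable e.open_target.measurableSet).mono_ac hν

theorem chartVolume_apply {A : Set M} (hA : MeasurableSet A) :
    chartVolume g e A =
      ∫⁻ y in e.target ∩ e.symm ⁻¹' A, ENNReal.ofReal (√(gram g e y).det) := by
  rw [chartVolume, Measure.map_apply_of_aemeasurable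
    (aemeasurable_chart_symm (withDensity_absolutelyContinuous _ _)) hA, withDensity_apply',
    Measure.restrict_restrict' e.open_target.measurableSet, inter_comm]

theorem chartVolume_apply_inter_source {A : Set M} (hA : MeasurableSet A) :
    chartVolume g e (A ∩ e.source) = chartVolume g e A := by
  rw [chartVolume_apply g hA, chartVolume_apply g (hA.inter e.open_source.measurableSet)]
  congr 2
  ext y
  simp only [mem_inter_iff, mem_preimage]
  exact ⟨fun h => ⟨h.1, h.2.1⟩, fun h => ⟨h.1, h.2, e.map_target h.1⟩⟩

/-- The measures of two charts agree on the intersection of their sources. -/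
theorem chartVolume_eq_of_subset (he : e ∈ atlas 𝔼 M) (he' : e' ∈ atlas 𝔼 M) {A : Set M}
    (hA : MeasurableSet A) (h1 : A ⊆ e.source) (h2 : A ⊆ e'.source) :
    chartVolume g e' A = chartVolume g e A := by
  rw [chartVolume_apply g hA, chartVolume_apply g hA]
  set S := e.target ∩ e.symm ⁻¹' A
  have hS : MeasurableSet S := measurableSet_target_inter_preimage hA
  set T : 𝔼 → 𝔼 := fun z => e' (e.symm z) with hT
  have himage : e'.target ∩ e'.symm ⁻¹' A = T '' S := by
    ext z
    constructor
    · rintro ⟨hz, hzA⟩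
      refine ⟨e (e'.symm z), ⟨e.map_source (h1 hzA), ?_⟩, ?_⟩
      · rwa [mem_preimage, e.left_inv (h1 hzA)]
      · simp only [hT]
        rw [e.left_inv (h1 hzA), e'.right_inv hz]
    · rintro ⟨y, ⟨-, hyA⟩, rfl⟩
      refine ⟨e'.map_source (h2 hyA), ?_⟩
      rwa [mem_preimage, e'.left_inv (h2 hyA)]
  have hinj : InjOn T S := by
    intro y hy z hz hyz
    exact e.symm.injOn hy.1 hz.1 (e'.injOn (h2 hy.2) (h2 hz.2) hyz)
  have hd : ∀ y ∈ S, HasFDerivWithinAt T (fderiv ℝ T y) S y := by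
    intro y hy
    have h : MDifferentiableAt (𝓡 n) (𝓡 n) T y :=
      ((chart_mdifferentiable he').mdifferentiableAt (h2 hy.2)).comp y
        ((chart_mdifferentiable he).mdifferentiableAt_symm hy.1)
    exact (mdifferentiableAt_iff_differentiableAt.1 h).hasFDerivAt.hasFDerivWithinAt
  -- The Jacobian in the change of variables is exactly the factor between the two densities given
  -- by `det_gram_change`.
  rw [himage, lintegral_image_eq_lintegral_abs_det_fderiv_mul volume hS hd hinj]
  refine setLIntegral_congr_fun hS fun y hy => ?_
  rw [det_gram_change g he he' hy.1 (h2 hy.2), Real.sqrt_mul (sq_nonneg _), Real.sqrt_sq_eq_abs,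
    ENNReal.ofReal_mul (abs_nonneg _)]

omit [BorelSpace M] in
theorem chartVolume_le (he : e ∈ atlas 𝔼 M) : chartVolume g e ≤ riemannianVolume g :=
  le_iSup₂_of_le (f := fun e (_ : e ∈ atlas 𝔼 M) => chartVolume g e) e he le_rfl

/-- The Riemannian volume restricts to the measure of a chart on its source. -/
theorem riemannianVolume_restrict (he : e ∈ atlas 𝔼 M) :
    (riemannianVolume g).restrict e.source = chartVolume g e := by
  have hms := e.open_source.measurableSet
  -- The volume is the least upper bound of the chart measures, so it suffices that the right side
  -- dominates each of them: split a set along `e.source` and use agreement on overlaps inside.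
  have hle : riemannianVolume g ≤
      chartVolume g e + (riemannianVolume g).restrict e.sourceᶜ := by
    refine iSup₂_le fun e' he' => Measure.le_iff.2 fun A hA => ?_
    rw [← measure_inter_add_sdiff A hms, Measure.add_apply, Measure.restrict_apply hA]
    refine add_le_add ?_ (chartVolume_le g he' _)
    rw [← chartVolume_apply_inter_source g (hA.inter hms),
      chartVolume_eq_of_subset g he he' ((hA.inter hms).inter e'.open_source.measurableSet)
        (inter_subset_left.trans inter_subset_right) inter_subset_right]
    exact measure_mono (inter_subset_left.trans inter_subset_left)
  refine le_antisymm (Measure.le_iff.2 fun A hA => ?_) (Measure.le_iff.2 fun A hA => ?_)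
  · rw [Measure.restrict_apply hA]
    refine (hle _).trans ?_
    rw [Measure.add_apply, Measure.restrict_apply (hA.inter hms), inter_assoc, inter_compl_self,
      inter_empty, measure_empty, add_zero]
    exact measure_mono inter_subset_left
  · rw [Measure.restrict_apply hA, ← chartVolume_apply_inter_source g hA]
    exact chartVolume_le g he _

omit [MeasurableSpace M] [BorelSpace M] in
theorem aemeasurable_density (he : e ∈ atlas 𝔼 M) :
    AEMeasurable (fun y => √(gram g e y).det) (volume.restrict e.target) :=
  (sqrt_det_gram_contDiffOn g he).continuousOn.aemeasurable e.open_target.measurableSet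

omit [IsManifold (𝓡 n) ∞ M] [ChartedSpace (EuclideanSpace ℝ (Fin n)) M] in
theorem measurableEmbedding_chart_symm :
    MeasurableEmbedding fun y : e.target => e.symm y := by
  have h : IsOpenEmbedding fun y : e.target => e.symm y := e.symm.isOpenEmbedding_restrict
  exact h.measurableEmbedding

/-- The measure of a chart as the image under a measurable embedding. -/
theorem exists_chartVolume_eq_map : ∃ κ : Measure e.target,
    κ.map Subtype.val =
      (volume.restrict e.target).withDensity (fun y => ENNReal.ofReal (√(gram g e y).det)) ∧
    chartVolume g e = κ.map fun y : e.target => e.symm y := by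
  set ν : Measure 𝔼 :=
    (volume.restrict e.target).withDensity fun y => ENNReal.ofReal (√(gram g e y).det) with hν
  have hmt := e.open_target.measurableSet
  have hκ : (ν.comap (Subtype.val : e.target → 𝔼)).map Subtype.val = ν := by
    rw [map_comap_subtype_coe hmt, hν, restrict_withDensity hmt, Measure.restrict_restrict hmt,
      inter_self]
  refine ⟨ν.comap Subtype.val, hκ, ?_⟩
  have h1 : AEMeasurable e.symm ((ν.comap (Subtype.val : e.target → 𝔼)).map Subtype.val) := by
    rw [hκ]
    exact aemeasurable_chart_symm (withDensity_absolutelyContinuous _ _)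
  have h2 := AEMeasurable.map_map_of_aemeasurable h1 measurable_subtype_coe.aemeasurable
  rw [hκ] at h2
  exact h2

/-- A property that holds almost everywhere in every chart holds almost everywhere. -/
theorem ae_riemannianVolume_of_charts [SecondCountableTopology M] {p : M → Prop}
    (hp : ∀ e ∈ atlas 𝔼 M, ∀ᵐ y, y ∈ e.target → p (e.symm y)) :
    ∀ᵐ x ∂riemannianVolume g, p x := by
  obtain ⟨s, hs, hcov⟩ := TopologicalSpace.countable_cover_nhds
    (fun x : M => (chartAt 𝔼 x).open_source.mem_nhds (mem_chart_source 𝔼 x))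
  rw [← Measure.restrict_univ (μ := riemannianVolume g), ← hcov, ae_restrict_biUnion_iff _ hs]
  intro x _
  have he := chart_mem_atlas 𝔼 x
  rw [riemannianVolume_restrict g he]
  obtain ⟨κ, hκ, hcv⟩ := exists_chartVolume_eq_map g (e := chartAt 𝔼 x)
  have hmt := (chartAt 𝔼 x).open_target.measurableSet
  rw [hcv, measurableEmbedding_chart_symm.ae_map_iff,
    ← (MeasurableEmbedding.subtype_coe hmt).ae_map_iff (p := fun y => p ((chartAt 𝔼 x).symm y)), hκ]
  exact (withDensity_absolutelyContinuous _ _).ae_le ((ae_restrict_iff' hmt).2 (hp _ he))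

/-- Integrals over the manifold of functions supported in the source of a chart. -/
theorem integrable_and_integral_chart (he : e ∈ atlas 𝔼 M) {F : M → ℝ}
    (hF : ∀ x ∉ e.source, F x = 0) :
    (Integrable F (riemannianVolume g) ↔
      IntegrableOn (fun y => √(gram g e y).det * F (e.symm y)) e.target volume) ∧
    ∫ x, F x ∂riemannianVolume g = ∫ y in e.target, √(gram g e y).det * F (e.symm y) := by
  obtain ⟨κ, hκ, hcv⟩ := exists_chartVolume_eq_map g (e := e)
  have hj := measurableEmbedding_chart_symm (e := e)
  have hval : MeasurableEmbedding (Subtype.val : e.target → 𝔼) :=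
    MeasurableEmbedding.subtype_coe e.open_target.measurableSet
  have hdens := (aemeasurable_density g he).ennreal_ofReal
  have hfin : ∀ᵐ y ∂volume.restrict e.target, ENNReal.ofReal (√(gram g e y).det) < ⊤ :=
    Eventually.of_forall fun _ => ENNReal.ofReal_lt_top
  have htr : ∀ y, (ENNReal.ofReal (√(gram g e y).det)).toReal = √(gram g e y).det := fun y =>
    ENNReal.toReal_ofReal (Real.sqrt_nonneg _)
  constructor
  · rw [← integrableOn_iff_integrable_of_support_subset (s := e.source)
      (fun x hx => by_contra fun h => hx (hF x h)), IntegrableOn, riemannianVolume_restrict g he, hcv,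
      hj.integrable_map_iff]
    change Integrable ((fun y => F (e.symm y)) ∘ Subtype.val) κ ↔ _
    rw [← hval.integrable_map_iff, hκ, integrable_withDensity_iff_integrable_smul₀' hdens hfin]
    simp only [htr, smul_eq_mul, IntegrableOn]
  · rw [← setIntegral_eq_integral_of_forall_compl_eq_zero hF, riemannianVolume_restrict g he, hcv,
      hj.integral_map]
    have := hval.integral_map (μ := κ) (fun y => F (e.symm y))
    rw [← this, hκ, integral_withDensity_eq_integral_toReal_smul₀ hdens hfin]
    simp only [htr, smul_eq_mul]

end Volume

/-! ### Algebra of locally Lipschitz functions. -/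

section Lipschitz

variable {E F : Type*} [NormedAddCommGroup E] [NormedSpace ℝ E] [NormedAddCommGroup F]
  [NormedSpace ℝ F]

omit [NormedSpace ℝ E] in
theorem LocallyLipschitzOn.contDiffOn_comp {f : E → F} {G : F → ℝ} {s : Set E} {t : Set F}
    (hG : ContDiffOn ℝ 1 G t) (ht : IsOpen t) (hf : LocallyLipschitzOn s f) (hst : MapsTo f s t) :
    LocallyLipschitzOn s (fun x => G (f x)) := by
  intro x hx
  obtain ⟨C, v, hv, hC⟩ := hf hx
  obtain ⟨D, w, hw, hD⟩ :=
    (hG.contDiffAt (ht.mem_nhds (hst hx))).exists_lipschitzOnWith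
  refine ⟨D * C, v ∩ f ⁻¹' w, inter_mem hv ((hf.continuousOn x hx).preimage_mem_nhdsWithin hw), ?_⟩
  exact hD.comp (hC.mono inter_subset_left) fun y hy => hy.2

omit [NormedSpace ℝ E] in
theorem LocallyLipschitzOn.prodMk' {f g : E → ℝ} {s : Set E} (hf : LocallyLipschitzOn s f)
    (hg : LocallyLipschitzOn s g) : LocallyLipschitzOn s (fun x => (f x, g x)) := by
  intro x hx
  obtain ⟨C, v, hv, hC⟩ := hf hx
  obtain ⟨D, w, hw, hD⟩ := hg hx
  exact ⟨max C D, v ∩ w, inter_mem hv hw,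
    (hC.mono inter_subset_left).prodMk (hD.mono inter_subset_right)⟩

omit [NormedSpace ℝ E] in
theorem LocallyLipschitzOn.mul_real {f g : E → ℝ} {s : Set E} (hf : LocallyLipschitzOn s f)
    (hg : LocallyLipschitzOn s g) : LocallyLipschitzOn s (fun x => f x * g x) :=
  LocallyLipschitzOn.contDiffOn_comp (G := fun p : ℝ × ℝ => p.1 * p.2)
    (contDiff_fst.mul contDiff_snd).contDiffOn isOpen_univ (LocallyLipschitzOn.prodMk' hf hg)
    (mapsTo_univ _ _)

omit [NormedSpace ℝ E] in
theorem LocallyLipschitzOn.inv_real {f : E → ℝ} {s : Set E} (hf : LocallyLipschitzOn s f)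
    (h0 : ∀ x ∈ s, f x ≠ 0) : LocallyLipschitzOn s (fun x => (f x)⁻¹) :=
  LocallyLipschitzOn.contDiffOn_comp (G := fun p : ℝ => p⁻¹) (t := {0}ᶜ)
    (contDiffOn_inv ℝ) isOpen_compl_singleton hf fun x hx => h0 x hx

theorem ContDiffOn.locallyLipschitzOn_of_isOpen {f : E → ℝ} {s : Set E} (hs : IsOpen s)
    (hf : ContDiffOn ℝ 1 f s) : LocallyLipschitzOn s f := by
  intro x hx
  obtain ⟨D, w, hw, hD⟩ := (hf.contDiffAt (hs.mem_nhds hx)).exists_lipschitzOnWith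
  exact ⟨D, w, mem_nhdsWithin_of_mem_nhds hw, hD⟩

omit [NormedSpace ℝ E] in
theorem LocallyLipschitzOn.congr' {f f' : E → ℝ} {s : Set E} (hf : LocallyLipschitzOn s f)
    (h : EqOn f' f s) : LocallyLipschitzOn s f' := by
  intro x hx
  obtain ⟨C, v, hv, hC⟩ := hf hx
  refine ⟨C, v ∩ s, inter_mem hv self_mem_nhdsWithin, fun y hy z hz => ?_⟩
  rw [h hy.2, h hz.2]
  exact hC hy.1 hz.1

end Lipschitz

theorem locallyIntegrableOn_finsetSum {ι α : Type*} [TopologicalSpace α] [MeasurableSpace α]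
    {μ : Measure α} {s : Set α} {f : ι → α → ℝ} (t : Finset ι)
    (hf : ∀ i ∈ t, LocallyIntegrableOn (f i) s μ) :
    LocallyIntegrableOn (fun x => ∑ i ∈ t, f i x) s μ := by
  have h := Finset.sum_induction f (fun φ => LocallyIntegrableOn φ s μ) (fun _ _ h1 h2 => h1.add h2)
    (locallyIntegrable_zero.locallyIntegrableOn s) hf
  convert h using 1
  funext x
  simp

/-! ### Integration by parts inside one chart. -/

section ChartIdentity

variable {n : ℕ} {M : Type*} [TopologicalSpace M] [ChartedSpace (EuclideanSpace ℝ (Fin n)) M]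

local notation "𝔼" => EuclideanSpace ℝ (Fin n)

/-- The derivative `df(v)` of a real function in the direction of a tangent vector. -/
noncomputable def dirDeriv (f : M → ℝ) (x : M) (v : TangentSpace (𝓡 n) x) : ℝ :=
  mfderiv (𝓡 n) 𝓘(ℝ, ℝ) f x v

theorem dirDeriv_of_notMem_tsupport {f : M → ℝ} {x : M} (hx : x ∉ tsupport f)
    (v : TangentSpace (𝓡 n) x) : dirDeriv f x v = 0 := by
  have h : f =ᶠ[𝓝 x] fun _ => (0 : ℝ) := notMem_tsupport_iff_eventuallyEq.1 hx
  rw [dirDeriv, h.mfderiv_eq, mfderiv_const]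
  rfl

variable [IsManifold (𝓡 n) ∞ M] [MeasurableSpace M] [BorelSpace M] (g : SmoothMetric n M)
  {e : OpenPartialHomeomorph M (EuclideanSpace ℝ (Fin n))}

/-- Weak form of the affine divergence, tested in one chart against a locally Lipschitz function
with compact support. -/
theorem integral_dirDeriv_of_tsupport_subset_chart [T2Space M] (he : e ∈ atlas 𝔼 M) {u : M → ℝ}
    (hu : ContMDiff (𝓡 n) 𝓘(ℝ, ℝ) ∞ u) {lam mu τ : ℝ} (hτ : τ = (n + 1) * lam + mu)
    {X : (x : M) → TangentSpace (𝓡 n) x} {h : M → ℝ} (hdiv : HasWeakAffineDiv g u lam mu X h)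
    {ψ : M → ℝ} (hψ : LocallyLipschitzOn e.target fun y => ψ (e.symm y))
    (hψc : HasCompactSupport ψ) (hψs : tsupport ψ ⊆ e.source) :
    Integrable (fun x => Real.exp (u x) ^ τ * dirDeriv ψ x (X x)) (riemannianVolume g) ∧
    Integrable (fun x => Real.exp (u x) ^ τ * h x * ψ x) (riemannianVolume g) ∧
    ∫ x, Real.exp (u x) ^ τ * dirDeriv ψ x (X x) ∂riemannianVolume g =
      - ∫ x, Real.exp (u x) ^ τ * h x * ψ x ∂riemannianVolume g := by
  obtain ⟨hXint, hhint, hweak⟩ := hdiv e he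
  have hopen := e.open_target
  set ρ := weight g u τ e with hρ
  have hρC : ContDiffOn ℝ 1 ρ e.target := weight_contDiffOn g he hu τ
  have hρ0 : ∀ y ∈ e.target, 0 < ρ y := fun y hy => weight_pos g he u τ hy
  set p : 𝔼 → ℝ := fun y => ψ (e.symm y) with hp
  -- Testing against `ρ p` rather than `p` is the point: the terms from `∂ⱼρ` cancel the connection
  -- coefficients in the divergence.
  set θ : 𝔼 → ℝ := e.target.indicator (fun y => ρ y * p y) with hθ
  set K : Set 𝔼 := e '' tsupport ψ
  have hK : IsCompact K := hψc.isCompact.image_of_continuousOn (e.continuousOn.mono hψs)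
  have hKt : K ⊆ e.target := by
    rintro _ ⟨x, hx, rfl⟩
    exact e.map_source (hψs hx)
  have hKc : ∀ y ∈ e.target, y ∉ K → e.symm y ∉ tsupport ψ := fun y hy hyK hx =>
    hyK ⟨e.symm y, hx, e.right_inv hy⟩
  have hθK : ∀ y ∉ K, θ y = 0 := by
    intro y hy
    by_cases hyt : y ∈ e.target
    · rw [hθ, indicator_of_mem hyt, hp]
      simp [image_eq_zero_of_notMem_tsupport (hKc y hyt hy)]
    · exact indicator_of_notMem hyt _
  have hθeq : EqOn θ (fun y => ρ y * p y) e.target := fun y hy => indicator_of_mem hy _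
  have hθloc : LocallyLipschitzOn e.target θ :=
    LocallyLipschitzOn.congr' (LocallyLipschitzOn.mul_real
      (ContDiffOn.locallyLipschitzOn_of_isOpen hopen hρC) hψ) hθeq
  obtain ⟨C, hC⟩ := exists_lipschitzWith_of_locallyLipschitzOn hopen hθloc hK hKt hθK
  have hθsupp : tsupport θ ⊆ K :=
    closure_minimal (fun y hy => by_contra fun hyK => hy (hθK y hyK)) hK.isClosed
  have hθc : HasCompactSupport θ := hK.of_isClosed_subset (isClosed_tsupport _) hθsupp
  obtain ⟨B, hB⟩ : ∃ B, ∀ x, ‖θ x‖ ≤ B := hC.continuous.bounded_above_of_compact_support hθc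
  have hcoef : ∀ y ∈ e.target, ∀ j,
      partialDeriv j ρ y = ρ y * ∑ i, affineCoeff g u lam mu e y i i j := by
    intro y hy j
    rw [hρ, hτ]
    exact partialDeriv_weight g he hu lam mu hy j
  -- Only the traces are needed, and as logarithmic derivatives of the `C¹` function `ρ` they are
  -- continuous.
  have hcont : ∀ j, ContinuousOn (fun y => ∑ i, affineCoeff g u lam mu e y i i j) e.target := by
    intro j
    have h1 : ContinuousOn (fun y => partialDeriv j ρ y / ρ y) e.target :=
      ((hρC.continuousOn_fderiv_of_isOpen hopen le_rfl).clm_apply continuousOn_const).div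
        hρC.continuousOn fun y hy => (hρ0 y hy).ne'
    refine h1.congr fun y hy => ?_
    simp only
    rw [hcoef y hy j, mul_div_cancel_left₀ _ (hρ0 y hy).ne']
  set H : 𝔼 → ℝ := fun y =>
    h (e.symm y) - ∑ i, ∑ j, affineCoeff g u lam mu e y i i j * coordComp e X j y with hH
  have hHeq : H = fun y => h (e.symm y) -
      ∑ j, (∑ i, affineCoeff g u lam mu e y i i j) * coordComp e X j y := by
    funext y
    simp only [hH, Finset.sum_mul]
    rw [Finset.sum_comm]
  have hHint : LocallyIntegrableOn H e.target volume := by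
    rw [hHeq]
    refine hhint.sub ?_
    refine locallyIntegrableOn_finsetSum _ fun j _ => ?_
    exact (hXint j).continuousOn_mul (hcont j) hopen.isLocallyClosed
  obtain ⟨hI1, hI2, hI⟩ := weak_div_lipschitz hopen hXint hHint hweak hC hθc (hθsupp.trans hKt)
  have hI3 : Integrable (fun y => h (e.symm y) * θ y) volume :=
    LocallyIntegrableOn.integrable_mul_of_bound hhint hK hKt
      hC.continuous.aestronglyMeasurable hθK hB
  have hθ0 : ∀ y ∉ e.target, ∀ i, partialDeriv i θ y = 0 := by
    intro y hy i
    have : fderiv ℝ θ y = 0 := by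
      by_contra hne
      exact hy (hKt (hθsupp (support_fderiv_subset ℝ hne)))
    simp [partialDeriv, this]
  -- `R` is the expression that reduces to `ρ dp(X)` after the cancellation. As a combination of
  -- three integrable functions it gives both the integrability and the integral of that term.
  set R : 𝔼 → ℝ := fun y =>
    ∑ i, coordComp e X i y * partialDeriv i θ y + H y * θ y - h (e.symm y) * θ y with hR
  have hRint : Integrable R volume := (hI1.add hI2).sub hI3
  have hR0 : ∀ y ∉ e.target, R y = 0 := by
    intro y hy
    simp [hR, hθ0 y hy, hθK y fun hyK => hy (hKt hyK)]
  have hRI : ∫ y, R y = - ∫ y, h (e.symm y) * θ y := by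
    have h1 := integral_sub (hI1.add hI2) hI3
    have h2 := integral_add hI1 hI2
    rw [hI] at h2
    simp only [Pi.add_apply] at h1
    rw [hR, h1, h2]
    ring
  have hae : ∀ᵐ y ∂volume.restrict e.target, R y =
      √(gram g e y).det * (Real.exp (u (e.symm y)) ^ τ * dirDeriv ψ (e.symm y) (X (e.symm y))) := by
    rw [ae_restrict_iff' hopen.measurableSet]
    filter_upwards [hC.ae_differentiableAt] with y hyd hy
    have hnhds := hopen.mem_nhds hy
    have hρd : DifferentiableAt ℝ ρ y := (hρC.differentiableOn one_ne_zero).differentiableAt hnhds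
    -- Rademacher's theorem is applied to the globally Lipschitz `θ`; differentiability passes to `p
    -- = θ / ρ`.
    have hpd : DifferentiableAt ℝ p y := by
      refine (hyd.mul (hρd.inv (hρ0 y hy).ne')).congr_of_eventuallyEq ?_
      filter_upwards [hnhds] with z hz
      simp only [Pi.mul_apply, Pi.inv_apply, hθeq hz]
      field_simp [(hρ0 z hz).ne']
    have hθd : fderiv ℝ θ y = ρ y • fderiv ℝ p y + p y • fderiv ℝ ρ y := by
      have : θ =ᶠ[𝓝 y] fun y => ρ y * p y := by
        filter_upwards [hnhds] with z hz using hθeq hz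
      rw [this.fderiv_eq, fderiv_fun_mul hρd hpd]
    have hpart : ∀ i, partialDeriv i θ y = ρ y * partialDeriv i p y +
        p y * (ρ y * ∑ k, affineCoeff g u lam mu e y k k i) := by
      intro i
      rw [← hcoef y hy i]
      simp [partialDeriv, hθd]
    have hdir : dirDeriv ψ (e.symm y) (X (e.symm y)) =
        ∑ i, coordComp e X i y * partialDeriv i p y := mfderiv_eq_sum_coordComp he ψ X hy
    have hρy : √(gram g e y).det * Real.exp (u (e.symm y)) ^ τ = ρ y := rfl
    rw [← mul_assoc, hρy, hdir, hR, hHeq]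
    simp only [hpart, hθeq hy]
    rw [sub_mul, Finset.mul_sum, Finset.sum_mul, ← add_sub_assoc, sub_right_comm,
      add_sub_cancel_right, ← Finset.sum_sub_distrib]
    exact Finset.sum_congr rfl fun i _ => by ring
  have hF1 : ∀ x ∉ e.source, Real.exp (u x) ^ τ * dirDeriv ψ x (X x) = 0 := fun x hx => by
    rw [dirDeriv_of_notMem_tsupport (fun hx' => hx (hψs hx')), mul_zero]
  have hF2 : ∀ x ∉ e.source, Real.exp (u x) ^ τ * h x * ψ x = 0 := fun x hx => by
    rw [image_eq_zero_of_notMem_tsupport (fun hx' => hx (hψs hx')), mul_zero]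
  have hF2eq : EqOn (fun y => h (e.symm y) * θ y)
      (fun y => √(gram g e y).det * (Real.exp (u (e.symm y)) ^ τ * h (e.symm y) * ψ (e.symm y)))
      e.target := fun y hy => by
    simp only [hθeq hy, hρ, hp, weight]
    ring
  obtain ⟨hT1, hT1'⟩ := integrable_and_integral_chart g he hF1
  obtain ⟨hT2, hT2'⟩ := integrable_and_integral_chart g he hF2
  refine ⟨hT1.2 (hRint.integrableOn.congr hae), hT2.2 (hI3.integrableOn.congr_fun hF2eq
    hopen.measurableSet), ?_⟩
  rw [hT1', hT2', ← integral_congr_ae hae, ← setIntegral_congr_fun hopen.measurableSet hF2eq,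
    setIntegral_eq_integral_of_forall_compl_eq_zero hR0, hRI,
    setIntegral_eq_integral_of_forall_compl_eq_zero]
  intro y hy
  rw [hθK y fun hyK => hy (hKt hyK), mul_zero]

end ChartIdentity

/-- Rademacher's theorem is local: a set that is null near each of its points is null. -/
theorem LocallyLipschitzOn.ae_differentiableAt {E : Type*} [NormedAddCommGroup E] [NormedSpace ℝ E]
    [FiniteDimensional ℝ E] [MeasurableSpace E] [BorelSpace E] {μ : Measure E} [μ.IsAddHaarMeasure]
    {f : E → ℝ} {U : Set E} (hU : IsOpen U) (hf : LocallyLipschitzOn U f) :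
    ∀ᵐ y ∂μ, y ∈ U → DifferentiableAt ℝ f y := by
  have : μ {y | ¬ (y ∈ U → DifferentiableAt ℝ f y)} = 0 := by
    refine measure_null_of_locally_null _ fun x hx => ?_
    simp only [mem_ofPred_eq, Classical.not_imp] at hx
    obtain ⟨C, t, ht, hC⟩ := hf hx.1
    rw [hU.nhdsWithin_eq hx.1] at ht
    obtain ⟨v, hvt, hv, hxv⟩ := _root_.mem_nhds_iff.1 ht
    refine ⟨_, inter_mem_nhdsWithin _ (hv.mem_nhds hxv), ?_⟩
    have h := (hC.mono hvt).ae_differentiableWithinAt_of_mem (μ := μ)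
    refine measure_mono_null ?_ h
    rintro y ⟨hy, hyv⟩ hy'
    exact hy fun _ => (hy' hyv).differentiableAt (hv.mem_nhds hyv)
  exact this

/-! ### Picone's identity and integration by parts on the manifold. -/

section Main

variable {n : ℕ} {M : Type*} [TopologicalSpace M] [ChartedSpace (EuclideanSpace ℝ (Fin n)) M]

local notation "𝔼" => EuclideanSpace ℝ (Fin n)

theorem dirDeriv_mul {f q : M → ℝ} {x : M} (hf : MDifferentiableAt (𝓡 n) 𝓘(ℝ, ℝ) f x)
    (hq : MDifferentiableAt (𝓡 n) 𝓘(ℝ, ℝ) q x) (v : TangentSpace (𝓡 n) x) :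
    dirDeriv (fun z => f z * q z) x v = f x * dirDeriv q x v + q x * dirDeriv f x v := by
  have h := (hf.hasMFDerivAt.mul' hq.hasMFDerivAt).mfderiv
  refine (DFunLike.congr_fun h v).trans ?_
  change f x * dirDeriv q x v + dirDeriv f x v * q x = _
  ring

theorem dirDeriv_add {f q : M → ℝ} {x : M} (hf : MDifferentiableAt (𝓡 n) 𝓘(ℝ, ℝ) f x)
    (hq : MDifferentiableAt (𝓡 n) 𝓘(ℝ, ℝ) q x) (v : TangentSpace (𝓡 n) x) :
    dirDeriv (fun z => f z + q z) x v = dirDeriv f x v + dirDeriv q x v :=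
  DFunLike.congr_fun (hf.hasMFDerivAt.add hq.hasMFDerivAt).mfderiv v

theorem mdifferentiableAt_and_dirDeriv_sum {ι : Type*} {t : Finset ι} {f : ι → M → ℝ} {x : M}
    (hf : ∀ i ∈ t, MDifferentiableAt (𝓡 n) 𝓘(ℝ, ℝ) (f i) x) (v : TangentSpace (𝓡 n) x) :
    MDifferentiableAt (𝓡 n) 𝓘(ℝ, ℝ) (fun z => ∑ i ∈ t, f i z) x ∧
      dirDeriv (fun z => ∑ i ∈ t, f i z) x v = ∑ i ∈ t, dirDeriv (f i) x v := by
  classical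
  induction t using Finset.induction_on with
  | empty =>
    simp only [Finset.sum_empty]
    refine ⟨mdifferentiableAt_const, ?_⟩
    rw [dirDeriv, mfderiv_const]
    rfl
  | insert i t hi ih =>
    have h1 := hf i (Finset.mem_insert_self i t)
    obtain ⟨h2, h3⟩ := ih fun j hj => hf j (Finset.mem_insert_of_mem hj)
    simp only [Finset.sum_insert hi]
    exact ⟨h1.add h2, by rw [dirDeriv_add h1 h2, h3]⟩

theorem dirDeriv_smul (f : M → ℝ) (x : M) (c : ℝ) (v : TangentSpace (𝓡 n) x) :
    dirDeriv f x (c • v) = c * dirDeriv f x v :=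
  map_smul (mfderiv (𝓡 n) 𝓘(ℝ, ℝ) f x) c v

variable [IsManifold (𝓡 n) ∞ M] (g : SmoothMetric n M)

theorem inner_grad_eq_dirDeriv (f : M → ℝ) (x : M) (v : TangentSpace (𝓡 n) x) :
    g.inner x (grad g f x) v = dirDeriv f x v := inner_grad g f x v

theorem dirDeriv_grad_comm (f q : M → ℝ) (x : M) :
    dirDeriv f x (grad g q x) = dirDeriv q x (grad g f x) := by
  rw [← inner_grad_eq_dirDeriv g f, ← inner_grad_eq_dirDeriv g q]
  exact g.symm _ _ _

theorem normSq_affineGrad (u : M → ℝ) (lam mu : ℝ) (f : M → ℝ) (x : M) :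
    normSq g (affineGrad g u lam mu f x) =
      (Real.exp (u x) ^ (mu - lam)) ^ 2 * dirDeriv f x (grad g f x) := by
  rw [← inner_grad_eq_dirDeriv g f, normSq, affineGrad]
  simp only [map_smul, _root_.smul_apply, smul_eq_mul]
  ring

/-- Picone's identity, for `φ = q w`. -/
theorem picone_identity {φ w q : M → ℝ} {x : M} (hφ : φ = fun z => q z * w z)
    (hw : MDifferentiableAt (𝓡 n) 𝓘(ℝ, ℝ) w x) (hq : MDifferentiableAt (𝓡 n) 𝓘(ℝ, ℝ) q x) :
    dirDeriv φ x (grad g φ x) - w x ^ 2 * dirDeriv q x (grad g q x) =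
      dirDeriv (fun z => φ z * q z) x (grad g w x) := by
  have hφd : MDifferentiableAt (𝓡 n) 𝓘(ℝ, ℝ) φ x := by
    rw [hφ]
    exact hq.mul hw
  have h1 : ∀ v : TangentSpace (𝓡 n) x, dirDeriv φ x v = q x * dirDeriv w x v + w x * dirDeriv q x v := by
    intro v
    conv_lhs => rw [hφ]
    exact dirDeriv_mul hq hw v
  have h2 : φ x = q x * w x := congrFun hφ x
  rw [dirDeriv_mul hφd hq, h1 (grad g φ x), dirDeriv_grad_comm g w φ, dirDeriv_grad_comm g q φ, h1, h1,
    dirDeriv_grad_comm g w q, h2]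
  ring

/-- In a chart this is `∑ gⁱʲ ∂ᵢφ ∂ⱼφ`, with inverse metric coefficients continuous by the adjugate
formula. It makes the energy density of `φ` integrable against a locally integrable `a`. -/
theorem continuous_dirDeriv_grad {φ : M → ℝ} (hφ : ContMDiff (𝓡 n) 𝓘(ℝ, ℝ) ∞ φ) :
    Continuous fun x => dirDeriv φ x (grad g φ x) := by
  rw [continuous_iff_continuousAt]
  intro x
  set e := chartAt 𝔼 x
  have he : e ∈ atlas 𝔼 M := chart_mem_atlas 𝔼 x
  have hx : x ∈ e.source := mem_chart_source 𝔼 x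
  set p : Fin n → 𝔼 → ℝ := fun i y => partialDeriv i (fun z => φ (e.symm z)) y with hp
  have hpc : ∀ i, ContinuousOn (p i) e.target := fun i =>
    ((comp_chart_symm_contDiffOn he hφ).continuousOn_fderiv_of_isOpen e.open_target
      (by simp)).clm_apply continuousOn_const
  have hgc : ContinuousOn (fun y => gram g e y) e.target :=
    continuousOn_pi.2 fun i => continuousOn_pi.2 fun j => (gram_contDiffOn g he i j).continuousOn
  have hinv : ∀ i j, ContinuousOn (fun y => (gram g e y)⁻¹ i j) e.target := by
    intro i j
    simp only [Matrix.inv_def, Matrix.smul_apply, Ring.inverse_eq_inv', smul_eq_mul]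
    refine ContinuousOn.mul (ContinuousOn.inv₀ ?_ fun y hy => (gram_posDef g he hy).det_pos.ne') ?_
    · exact (Continuous.matrix_det continuous_id).comp_continuousOn hgc
    · exact ((Continuous.matrix_adjugate continuous_id).matrix_elem i j).comp_continuousOn hgc
  have heq : EqOn (fun y => dirDeriv φ (e.symm y) (grad g φ (e.symm y)))
      (fun y => ∑ i, (∑ j, (gram g e y)⁻¹ i j * p j y) * p i y) e.target := by
    intro y hy
    have h1 : dirDeriv φ (e.symm y) (grad g φ (e.symm y)) =
        ∑ i, coordComp e (grad g φ) i y * p i y := mfderiv_eq_sum_coordComp he φ (grad g φ) hy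
    have h2 : (gram g e y).mulVec (fun i => coordComp e (grad g φ) i y) = fun j => p j y := by
      funext j
      rw [hp]
      simp only
      rw [← sum_gram_mul_coordComp_grad g he φ hy j]
      simp only [Matrix.mulVec, dotProduct]
      exact Finset.sum_congr rfl fun i _ => by rw [gram_symm g]
    have h3 : (fun i => coordComp e (grad g φ) i y) =
        (gram g e y)⁻¹.mulVec fun j => p j y := by
      rw [← h2, Matrix.mulVec_mulVec, Matrix.nonsing_inv_mul _
        (gram_posDef g he hy).det_pos.ne'.isUnit, Matrix.one_mulVec]
    simp only
    rw [h1]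
    exact Finset.sum_congr rfl fun i _ => by rw [congrFun h3 i]; rfl
  have hcont : ContinuousOn (fun y => dirDeriv φ (e.symm y) (grad g φ (e.symm y))) e.target :=
    ContinuousOn.congr (continuousOn_finsetSum _ fun i _ => (continuousOn_finsetSum _ fun j _ =>
      (hinv i j).mul (hpc j)).mul (hpc i)) heq
  have hcomp := (hcont.continuousAt (e.open_target.mem_nhds (e.map_source hx))).comp
    (e.continuousAt hx)
  refine hcomp.congr ?_
  filter_upwards [e.open_source.mem_nhds hx] with z hz
  simp only [Function.comp]
  rw [e.left_inv hz]

variable [MeasurableSpace M] [BorelSpace M]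

theorem IsLocallyLipschitz.ae_mdifferentiableAt [SecondCountableTopology M] {f : M → ℝ}
    (hf : IsLocallyLipschitz n f) :
    ∀ᵐ x ∂riemannianVolume g, MDifferentiableAt (𝓡 n) 𝓘(ℝ, ℝ) f x := by
  refine ae_riemannianVolume_of_charts g fun e he => ?_
  filter_upwards [LocallyLipschitzOn.ae_differentiableAt (μ := volume) e.open_target (hf e he)]
    with y hy hyt
  exact (mdifferentiableAt_iff_chart he hyt).2 (hy hyt)

omit [MeasurableSpace M] [BorelSpace M] in
theorem ContMDiff.isLocallyLipschitz {f : M → ℝ} (hf : ContMDiff (𝓡 n) 𝓘(ℝ, ℝ) ∞ f) :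
    IsLocallyLipschitz n f := fun e he =>
  ContDiffOn.locallyLipschitzOn_of_isOpen e.open_target
    ((comp_chart_symm_contDiffOn he hf).of_le (by simp))

/-- Weak form of the affine divergence, tested against a locally Lipschitz function with compact
support. -/
theorem integral_dirDeriv_eq_neg_integral_div [T2Space M] [SecondCountableTopology M] {u : M → ℝ}
    (hu : ContMDiff (𝓡 n) 𝓘(ℝ, ℝ) ∞ u) {lam mu τ : ℝ} (hτ : τ = (n + 1) * lam + mu)
    {X : (x : M) → TangentSpace (𝓡 n) x} {h : M → ℝ} (hdiv : HasWeakAffineDiv g u lam mu X h)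
    {ψ : M → ℝ} (hψ : IsLocallyLipschitz n ψ) (hψc : HasCompactSupport ψ) :
    Integrable (fun x => Real.exp (u x) ^ τ * dirDeriv ψ x (X x)) (riemannianVolume g) ∧
    Integrable (fun x => Real.exp (u x) ^ τ * h x * ψ x) (riemannianVolume g) ∧
    ∫ x, Real.exp (u x) ^ τ * dirDeriv ψ x (X x) ∂riemannianVolume g =
      - ∫ x, Real.exp (u x) ^ τ * h x * ψ x ∂riemannianVolume g := by
  have : LocallyCompactSpace M := Manifold.locallyCompact_of_finiteDimensional (𝓡 n)
  obtain ⟨t, -, ht⟩ := hψc.isCompact.elim_nhds_subcover (fun x : M => (chartAt 𝔼 x).source)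
    fun x _ => (chartAt 𝔼 x).open_source.mem_nhds (mem_chart_source 𝔼 x)
  obtain ⟨χ, hχ⟩ := SmoothPartitionOfUnity.exists_isSubordinate (𝓡 n) (isClosed_tsupport ψ)
    (fun x : t => (chartAt 𝔼 (x : M)).source) (fun x => (chartAt 𝔼 (x : M)).open_source)
    (fun y hy => by simpa using ht hy)
  have hsum : ψ = fun x => ∑ k, χ k x * ψ x := by
    funext x
    by_cases hx : x ∈ tsupport ψ
    · rw [← Finset.sum_mul, ← finsum_eq_sum_of_fintype, χ.sum_eq_one hx, one_mul]
    · simp [image_eq_zero_of_notMem_tsupport hx]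
  have hχs : ∀ k, ContMDiff (𝓡 n) 𝓘(ℝ, ℝ) ∞ (χ k) := fun k => (χ k).contMDiff
  have hk := fun k : t => integral_dirDeriv_of_tsupport_subset_chart g
    (chart_mem_atlas 𝔼 (k : M)) hu hτ hdiv
    (ψ := fun x => χ k x * ψ x)
    (LocallyLipschitzOn.mul_real (ContMDiff.isLocallyLipschitz (hχs k) _ (chart_mem_atlas 𝔼 (k : M)))
      (hψ _ (chart_mem_atlas 𝔼 (k : M)))) hψc.mul_left
    ((tsupport_mul_subset_left (f := χ k) (g := ψ)).trans (hχ k))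
  -- The derivative of the sum splits only where `ψ` is differentiable, hence an almost everywhere
  -- identity.
  have hae : (fun x => ∑ k, Real.exp (u x) ^ τ * dirDeriv (fun x => χ k x * ψ x) x (X x))
      =ᵐ[riemannianVolume g] fun x => Real.exp (u x) ^ τ * dirDeriv ψ x (X x) := by
    filter_upwards [IsLocallyLipschitz.ae_mdifferentiableAt g hψ] with x hx
    conv_rhs => rw [hsum]
    rw [(mdifferentiableAt_and_dirDeriv_sum (f := fun k x => χ k x * ψ x)
      (fun k _ => ((hχs k).mdifferentiableAt (by simp)).mul hx) _).2, Finset.mul_sum]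
  have hh : (fun x => ∑ k, Real.exp (u x) ^ τ * h x * (χ k x * ψ x)) =
      fun x => Real.exp (u x) ^ τ * h x * ψ x := by
    funext x
    conv_rhs => rw [hsum]
    rw [Finset.mul_sum]
  refine ⟨(integrable_finsetSum _ fun k _ => (hk k).1).congr hae, ?_, ?_⟩
  · rw [← hh]
    exact integrable_finsetSum _ fun k _ => (hk k).2.1
  · rw [← integral_congr_ae hae, ← hh, integral_finsetSum _ fun k _ => (hk k).1,
      integral_finsetSum _ fun k _ => (hk k).2.1, ← Finset.sum_neg_distrib]
    exact Finset.sum_congr rfl fun k _ => (hk k).2.2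

end Main

end AffineHardy

/-! ### The Hardy-type inequality. -/

theorem mainTheorem3 {n : ℕ} {M : Type*} [TopologicalSpace M] [T2Space M]
    [SecondCountableTopology M] [ChartedSpace (EuclideanSpace ℝ (Fin n)) M]
    [IsManifold (𝓡 n) ∞ M] [MeasurableSpace M] [BorelSpace M]
    (g : AffineHardy.SmoothMetric n M)
    (u V : M → ℝ) (hu : ContMDiff (𝓡 n) 𝓘(ℝ, ℝ) ∞ u) (hV : ∀ x, V x = Real.exp (u x))
    (lam mu τ : ℝ) (hτ : τ = (n + 1) * lam + mu)
    (a b w : M → ℝ)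
    (ha : LocallyIntegrable a (AffineHardy.riemannianVolume g)) (ha0 : ∀ x, 0 ≤ a x)
    (hb : AEMeasurable b (AffineHardy.riemannianVolume g)) (hb0 : ∀ x, 0 ≤ b x)
    (hw : AffineHardy.IsLocallyLipschitz n w) (hw0 : ∀ x, 0 < w x)
    (h : M → ℝ)
    (hdiv : AffineHardy.HasWeakAffineDiv g u lam mu
      (fun x => a x • AffineHardy.affineGrad g u lam mu w x) h)
    (hineq : ∀ᵐ x ∂(AffineHardy.riemannianVolume g),
      -(V x ^ τ) * h x ≥ b x * w x * V x ^ (τ + mu - lam))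
    (φ : M → ℝ) (hφ : ContMDiff (𝓡 n) 𝓘(ℝ, ℝ) ∞ φ) (hφc : HasCompactSupport φ) :
    Integrable (fun x => a x * AffineHardy.normSq g (AffineHardy.affineGrad g u lam mu φ x)
      * V x ^ (τ + lam - mu)) (AffineHardy.riemannianVolume g) ∧
    Integrable (fun x => b x * φ x ^ 2 * V x ^ (τ + mu - lam))
      (AffineHardy.riemannianVolume g) ∧
    Integrable (fun x => a x * w x ^ 2 *
      AffineHardy.normSq g (AffineHardy.affineGrad g u lam mu (fun z => φ z / w z) x)
      * V x ^ (τ + lam - mu)) (AffineHardy.riemannianVolume g) ∧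
    ∫ x, (a x * AffineHardy.normSq g (AffineHardy.affineGrad g u lam mu φ x)
        * V x ^ (τ + lam - mu)
      - b x * φ x ^ 2 * V x ^ (τ + mu - lam)) ∂(AffineHardy.riemannianVolume g)
    ≥ ∫ x, a x * w x ^ 2 *
        AffineHardy.normSq g (AffineHardy.affineGrad g u lam mu (fun z => φ z / w z) x)
        * V x ^ (τ + lam - mu) ∂(AffineHardy.riemannianVolume g) := by
  have hVu : V = fun x => Real.exp (u x) := funext hV
  subst hVu
  simp only at hineq ⊢
  set vol := AffineHardy.riemannianVolume g
  set q : M → ℝ := fun z => φ z / w z with hq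
  set ψ : M → ℝ := fun z => φ z * q z with hψ
  set X : (x : M) → TangentSpace (𝓡 n) x :=
    fun x => a x • AffineHardy.affineGrad g u lam mu w x with hX
  set A : M → ℝ := fun x => a x * AffineHardy.normSq g (AffineHardy.affineGrad g u lam mu φ x)
    * Real.exp (u x) ^ (τ + lam - mu) with hA
  set B : M → ℝ := fun x => b x * φ x ^ 2 * Real.exp (u x) ^ (τ + mu - lam) with hB
  set C : M → ℝ := fun x => a x * w x ^ 2 *
    AffineHardy.normSq g (AffineHardy.affineGrad g u lam mu q x)
    * Real.exp (u x) ^ (τ + lam - mu) with hC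
  set G : M → ℝ := fun x => Real.exp (u x) ^ τ * AffineHardy.dirDeriv ψ x (X x) with hG
  set H : M → ℝ := fun x => Real.exp (u x) ^ τ * h x * ψ x with hH
  have hφw : φ = fun z => q z * w z := funext fun z => (div_mul_cancel₀ _ (hw0 z).ne').symm
  have hqL : AffineHardy.IsLocallyLipschitz n q := fun e he => by
    simp only [hq, div_eq_mul_inv]
    exact AffineHardy.LocallyLipschitzOn.mul_real (AffineHardy.ContMDiff.isLocallyLipschitz hφ e he)
      (AffineHardy.LocallyLipschitzOn.inv_real (hw e he) fun y _ => (hw0 _).ne')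
  have hψL : AffineHardy.IsLocallyLipschitz n ψ := fun e he =>
    AffineHardy.LocallyLipschitzOn.mul_real (AffineHardy.ContMDiff.isLocallyLipschitz hφ e he)
      (hqL e he)
  have hψc : HasCompactSupport ψ := hφc.mul_right
  obtain ⟨hGi, hHi, hGH⟩ :=
    AffineHardy.integral_dirDeriv_eq_neg_integral_div g hu hτ hdiv hψL hψc
  have hucont : Continuous fun x => Real.exp (u x) := Real.continuous_exp.comp hu.continuous
  have hpow : ∀ s : ℝ, Continuous fun x => Real.exp (u x) ^ s := fun s =>
    hucont.rpow_const fun x => Or.inl (Real.exp_pos _).ne'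
  have hAi : Integrable A vol := by
    have hc : Continuous fun x => AffineHardy.normSq g (AffineHardy.affineGrad g u lam mu φ x)
        * Real.exp (u x) ^ (τ + lam - mu) := by
      simp only [AffineHardy.normSq_affineGrad]
      exact (((hpow _).pow 2).mul (AffineHardy.continuous_dirDeriv_grad g hφ)).mul (hpow _)
    have hs : HasCompactSupport fun x =>
        AffineHardy.normSq g (AffineHardy.affineGrad g u lam mu φ x)
          * Real.exp (u x) ^ (τ + lam - mu) := by
      refine HasCompactSupport.intro hφc.isCompact fun x hx => ?_
      rw [AffineHardy.normSq_affineGrad, AffineHardy.dirDeriv_of_notMem_tsupport hx]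
      ring
    refine (ha.integrable_smul_right_of_hasCompactSupport hc hs).congr (Filter.Eventually.of_forall
      fun x => ?_)
    simp only [hA, smul_eq_mul, mul_assoc]
  have hpicone : ∀ᵐ x ∂vol, A x - G x = C x := by
    filter_upwards [AffineHardy.IsLocallyLipschitz.ae_mdifferentiableAt g hw,
      AffineHardy.IsLocallyLipschitz.ae_mdifferentiableAt g hqL] with x hwx hqx
    have h1 := AffineHardy.picone_identity g hφw hwx hqx
    have h2 : AffineHardy.dirDeriv ψ x (X x) = a x * (Real.exp (u x) ^ (mu - lam) *
        AffineHardy.dirDeriv ψ x (AffineHardy.grad g w x)) := by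
      rw [← AffineHardy.dirDeriv_smul, ← AffineHardy.dirDeriv_smul]
      rfl
    -- With this splitting, all three terms carry the same total weight `V^(τ + mu - lam)`, two of
    -- them through the squared factor in `normSq_affineGrad`.
    have h3 : Real.exp (u x) ^ τ =
        Real.exp (u x) ^ (mu - lam) * Real.exp (u x) ^ (τ + lam - mu) := by
      rw [← Real.rpow_add (Real.exp_pos _)]
      congr 1
      ring
    simp only [hA, hG, hC]
    rw [h2, ← h1, h3, AffineHardy.normSq_affineGrad, AffineHardy.normSq_affineGrad]
    ring
  -- Picone's identity also gives integrability of the remainder, about which nothing was known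
  -- beforehand.
  have hCi : Integrable C vol := (hAi.sub hGi).congr hpicone
  have hBH : ∀ᵐ x ∂vol, B x ≤ -H x := by
    filter_upwards [hineq] with x hx
    -- The differential inequality is multiplied by the nonnegative test function `ψ = φ² / w`. The
    -- result both dominates `B` by an integrable function and compares the integrals.
    have h1 : 0 ≤ φ x ^ 2 / w x := div_nonneg (sq_nonneg _) (hw0 x).le
    have h2 := mul_le_mul_of_nonneg_right hx h1
    have h3 : b x * w x * Real.exp (u x) ^ (τ + mu - lam) * (φ x ^ 2 / w x) = B x := by
      have := (hw0 x).ne'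
      simp only [hB]
      field_simp
    have h4 : -(Real.exp (u x) ^ τ) * h x * (φ x ^ 2 / w x) = -H x := by
      simp only [hH, hψ, hq]
      ring
    rwa [h3, h4] at h2
  have hB0 : ∀ x, 0 ≤ B x := fun x =>
    mul_nonneg (mul_nonneg (hb0 x) (sq_nonneg _)) (Real.rpow_nonneg (Real.exp_pos _).le _)
  have hBi : Integrable B vol := by
    refine hHi.neg.mono' ?_ ?_
    · exact ((hb.mul (hφ.continuous.pow 2).measurable.aemeasurable).mul
        (hpow _).measurable.aemeasurable).aestronglyMeasurable
    · filter_upwards [hBH] with x hx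
      rw [Real.norm_of_nonneg (hB0 x)]
      exact hx
  refine ⟨hAi, hBi, hCi, ?_⟩
  have hle : ∫ x, B x ∂vol ≤ ∫ x, G x ∂vol := by
    rw [hGH, ← integral_neg]
    exact integral_mono_ae hBi hHi.neg hBH
  have hCint : ∫ x, C x ∂vol = ∫ x, A x ∂vol - ∫ x, G x ∂vol := by
    rw [← integral_sub hAi hGi]
    exact (integral_congr_ae hpicone).symm
  have hAB : ∫ x, (A x - B x) ∂vol = ∫ x, A x ∂vol - ∫ x, B x ∂vol := integral_sub hAi hBi
  change ∫ x, C x ∂vol ≤ ∫ x, (A x - B x) ∂vol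
  rw [hAB, hCint]
  linarith
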